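/- Let \(G\) be a countable group. A positive cone of \(G\) is a set \(P\subseteq G\) with \(P\cdot P\subseteq P\) such that \(G\setminus\{1\}\) is the disjoint union of \(P\) and \(P^{-1}\); positive cones correspond to the left-orderings of \(G\) via \(P=\{g : g>1\}\). Let \(\mathrm{LO}(G)\) be the set of positive cones of \(G\), with the subspace topology inherited from \(\{0,1\}^G\) (product of discrete topologies), and let \(E_{\mathsf{lo}}(G)\) be the orbit equivalence relation of the conjugacy action \(g\cdot P=gPg^{-1}\) of \(G\) on \(\mathrm{LO}(G)\). The group \(G\) is a Tararin group if it admits at least one but only finitely many left-orderings. The relation \(E_{\mathsf{lo}}(G)\) is smooth if there are a standard Borel space \(Y\) and a Borel map \(\theta\colon \mathrm{LO}(G)\to Y\) such that \(P\mathbin{E_{\mathsf{lo}}(G)}Q\iff\theta(P)=\theta(Q)\) for all \(P,Q\in\mathrm{LO}(G)\). Suppose that \(G\) is not a Tararin group. If \(\mathrm{LO}(G)\) contains an isolated point, then \(E_{\mathsf{lo}}(G)\) is not smooth. -/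

import Mathlib

open scoped Pointwise

universe u v

/-- A positive cone of a group `G`: a subsemigroup `P` such that `G \ {1}` is the disjoint union of
`P` and `P⁻¹`. Positive cones correspond to left-orderings through `P = {g | 1 < g}` and
`g < h ↔ g⁻¹ * h ∈ P`. -/
structure IsPositiveCone {G : Type*} [Group G] (P : Set G) : Prop where
  mul_subset : P * P ⊆ P
  disjoint_inv : Disjoint P P⁻¹
  union_inv : P ∪ P⁻¹ = {1}ᶜ

/-- The space `LO(G)` of left-orderings of `G`, identified with their positive cones. -/
def LO (G : Type*) [Group G] : Type _ := {P : Set G // IsPositiveCone P}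

namespace LO

variable {G : Type*} [Group G]

/-- The topology of `LO(G)` as a subspace of `{0,1}^G`, the latter with the product of the discrete
topologies; a cone is regarded as its indicator function `G → Bool`. -/
noncomputable instance instTopologicalSpace : TopologicalSpace (LO G) :=
  TopologicalSpace.induced (fun P : LO G => (Set.boolIndicator P.1 : G → Bool))
    Pi.topologicalSpace

/-- A conjugate `g P g⁻¹` of a positive cone is a positive cone. -/
theorem isPositiveCone_conj (g : G) {P : Set G} (hP : IsPositiveCone P) :
    IsPositiveCone ((fun x => g * x * g⁻¹) '' P) := by
  have hmem : ∀ {Q : Set G} (x : G), x ∈ (fun x => g * x * g⁻¹) '' Q ↔ g⁻¹ * x * g ∈ Q := by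
    intro Q x
    constructor
    · rintro ⟨y, hy, rfl⟩
      simpa [mul_assoc] using hy
    · intro h
      exact ⟨_, h, by group⟩
  have hinv : ((fun x => g * x * g⁻¹) '' P)⁻¹ = (fun x => g * x * g⁻¹) '' P⁻¹ := by
    ext x
    rw [Set.mem_inv, hmem, hmem, Set.mem_inv]
    simp [mul_assoc]
  refine ⟨?_, ?_, ?_⟩
  · rintro _ ⟨_, ⟨x, hx, rfl⟩, _, ⟨y, hy, rfl⟩, rfl⟩
    exact ⟨x * y, hP.mul_subset (Set.mul_mem_mul hx hy), by group⟩
  · rw [hinv, Set.disjoint_left]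
    intro x hx hx'
    exact Set.disjoint_left.1 hP.disjoint_inv ((hmem x).1 hx) ((hmem x).1 hx')
  · rw [hinv, ← Set.image_union, hP.union_inv]
    ext x
    rw [hmem]
    simp [mul_assoc, inv_mul_eq_one]

/-- The conjugacy action of `G` on `LO(G)`, given by `g • P = g P g⁻¹`. -/
instance instMulAction : MulAction G (LO G) where
  smul g P := ⟨(fun x => g * x * g⁻¹) '' P.1, isPositiveCone_conj g P.2⟩
  one_smul P := Subtype.ext (show (fun x => 1 * x * 1⁻¹) '' P.1 = P.1 by simp)
  mul_smul g h P := Subtype.ext (show (fun x => g * h * x * (g * h)⁻¹) '' P.1 =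
      (fun x => g * x * g⁻¹) '' ((fun x => h * x * h⁻¹) '' P.1) by
    rw [Set.image_image]
    simp [mul_assoc])

end LO

/-- The conjugacy relation `E_lo(G)`: the orbit equivalence relation of the conjugacy action of `G`
on `LO(G)`. -/
def Elo (G : Type*) [Group G] : Setoid (LO G) := MulAction.orbitRel G (LO G)

/-- An equivalence relation on a topological space `X` is smooth if there are a standard Borel space
`Y` and a Borel map `θ : X → Y` such that `x₁ E x₂ ↔ θ x₁ = θ x₂`. -/
def IsSmoothRel {X : Type u} [TopologicalSpace X] (E : Setoid X) : Prop :=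
  ∃ (Y : Type v) (_ : MeasurableSpace Y) (_ : StandardBorelSpace Y) (θ : X → Y),
    @Measurable X Y (borel X) _ θ ∧ ∀ x₁ x₂ : X, E x₁ x₂ ↔ θ x₁ = θ x₂

/-- A Tararin group: a left-orderable group that admits only finitely many left-orderings. -/
def IsTararin (G : Type*) [Group G] : Prop := Nonempty (LO G) ∧ Finite (LO G)

/-! Call a cone condensed if it is an accumulation point of its own conjugacy orbit. Two facts
together give the theorem: a condensed cone rules out smoothness, and a group with an isolated cone
but no condensed cone has only finitely many cones.

The first is Baire category (`not_isSmoothRel_of_mem_derivedSet_orbit`). On the closure of the orbit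
of a condensed cone there is a dense orbit and no isolated point. A Borel invariant is constant on a
residual set by the zero-one law, so a complete invariant would make a single countable orbit
residual, although its points are nowhere dense.

The second (`IsolatedBy.isTame`) is an induction on the size of a finite set `S` that isolates a
cone `P`. Isolation yields a largest proper convex subgroup `H`. If the action on `G ⧸ H` moves
points arbitrarily near the base point in inconsistent directions, a compactness and Zorn argument
produces a condensed cone (`IsConvexFor.exists_isCondensed`). Otherwise `H` is normal and `G ⧸ H` is
bi-ordered and Archimedean, hence commutative by Hölder, and of rank one because its induced order
is again isolated. The restriction of `P` to `H` is isolated by fewer elements, and a condensed cone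
of `H` would extend to `G`, so induction applies to `H`. If `H` is nontrivial, this gives `K < H`
convex for all orders of `H`, with `H ⧸ K` of rank one.

It remains to see that `H` is convex for every order of `G`; an order is then determined by its
restriction to `H` and one sign. Some element of `G` must invert the order on `H ⧸ K`, for otherwise
`G ⧸ K` would be commutative of rank above one or carry affine-type orders approximating the given
one (`not_isolatedBy_of_conj_mem`). An inverting element in turn forces `H` to be convex for every
order (`isConvexFor_of_inverting`). -/

/-! ### Recurrent orbits and non-smoothness -/

section OrbitAccumulation

variable {X : Type*} [TopologicalSpace X] {G : Type*} [Group G] [MulAction G X]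
  [ContinuousConstSMul G X]

open MulAction Topology Set

theorem orbit_subset_closure_orbit {x y : X} (h : y ∈ closure (orbit G x)) :
    orbit G y ⊆ closure (orbit G x) := by
  rintro _ ⟨g, rfl⟩
  have hmaps : MapsTo (fun z : X => g • z) (orbit G x) (orbit G x) := by
    rintro _ ⟨k, rfl⟩
    exact ⟨g * k, mul_smul g k x⟩
  exact map_mem_closure (continuous_const_smul g) h hmaps

/-- Accumulation on orbits is transitive: in a T1 space a set and its closure have the same
accumulation points. -/
theorem derivedSet_orbit_subset [T1Space X] {x y : X} (h : y ∈ derivedSet (orbit G x)) :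
    derivedSet (orbit G y) ⊆ derivedSet (orbit G x) := by
  rw [← derivedSet_closure (orbit G x)]
  exact derivedSet_mono _ _ (orbit_subset_closure_orbit (G := G) (derivedSet_subset_closure _ h))

/-- A closed set in which every orbit accumulates contains a point that is an accumulation point
of its own orbit. -/
theorem exists_mem_derivedSet_orbit [CompactSpace X] [T1Space X] {F : Set X} (hF : IsClosed F)
    (hne : F.Nonempty) (hacc : ∀ x ∈ F, (derivedSet (orbit G x) ∩ F).Nonempty) :
    ∃ x : X, x ∈ derivedSet (orbit G x) := by
  -- `F` need not be invariant, so admissible sets are only required to absorb the part of each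
  -- derived set that lies in `F`.
  let S : Set (Set X) := {K | K ⊆ F ∧ IsClosed K ∧ K.Nonempty ∧
    ∀ x ∈ K, derivedSet (orbit G x : Set X) ∩ F ⊆ K}
  obtain ⟨K, -, hK⟩ := zorn_superset_nonempty S (by
    intro c hc hchain hcne
    refine ⟨⋂₀ c, ⟨?_, isClosed_sInter fun t ht => (hc ht).2.1, ?_, ?_⟩,
      fun s hs => sInter_subset_of_mem hs⟩
    · obtain ⟨t, ht⟩ := hcne
      exact (sInter_subset_of_mem ht).trans (hc ht).1
    · have := hcne.to_subtype
      exact IsCompact.nonempty_sInter_of_directed_nonempty_isCompact_isClosed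
        (fun s hs t ht => (hchain.total hs ht).elim (fun h => ⟨s, hs, Subset.rfl, h⟩)
          (fun h => ⟨t, ht, h, Subset.rfl⟩)) (fun t ht => (hc ht).2.2.1)
        (fun t ht => (hc ht).2.1.isCompact) (fun t ht => (hc ht).2.1)
    · intro x hx
      exact subset_sInter fun t ht => (hc ht).2.2.2 x (hx t ht)) F
      ⟨subset_rfl, hF, hne, fun _ _ => inter_subset_right⟩
  obtain ⟨hKF, hKcl, ⟨x, hx⟩, hKacc⟩ := hK.prop
  -- By transitivity this subset of the minimal set `K` is itself admissible, hence equals `K` and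
  -- contains `x`.
  have hmem : derivedSet (orbit G x) ∩ F ∈ S := by
    refine ⟨inter_subset_right, (isClosed_derivedSet _).inter hF, hacc x (hKF hx), ?_⟩
    intro y hy
    exact inter_subset_inter_left _ (derivedSet_orbit_subset hy.1)
  exact ⟨x, (hK.le_of_le hmem (hKacc x hx) hx).1⟩

/-- The topological zero-one law for actions with a dense orbit. -/
theorem mem_residual_or_compl_mem_residual [Countable G] {x : X} (hx : Dense (orbit G x))
    {A : Set X} (hA : BaireMeasurableSet A) (hinv : ∀ (g : G) (y : X), g • y ∈ A ↔ y ∈ A) :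
    A ∈ residual X ∨ Aᶜ ∈ residual X := by
  obtain ⟨U, hU, hAU⟩ := hA.residualEq_isOpen
  rcases U.eq_empty_or_nonempty with rfl | hne
  · right
    filter_upwards [hAU] with y hy
    have : (y ∈ A) = False := hy
    simp [this]
  · left
    -- Once the dense orbit meets `U`, each of its points can be moved into `U`, so the translates
    -- of `U` cover the whole orbit.
    have hdense : Dense (⋃ g : G, (fun y : X => g • y) ⁻¹' U) := by
      obtain ⟨_, hg, ⟨g, rfl⟩⟩ := hx.inter_open_nonempty U hU hne
      refine hx.mono ?_
      rintro _ ⟨k, rfl⟩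
      refine mem_iUnion.2 ⟨g * k⁻¹, ?_⟩
      simpa [mul_smul] using hg
    have hopen : IsOpen (⋃ g : G, (fun y : X => g • y) ⁻¹' U) :=
      isOpen_iUnion fun g => hU.preimage (continuous_const_smul g)
    have hres : ∀ g : G, ∀ᶠ y in residual X, (g • y ∈ A) = (g • y ∈ U) := by
      intro g
      exact (tendsto_residual_of_isOpenMap (continuous_const_smul g)
        (isOpenMap_smul g)).eventually hAU
    filter_upwards [residual_of_dense_open hopen hdense, eventually_countable_forall.2 hres]
      with y hy hyA
    obtain ⟨g, hg⟩ := mem_iUnion.1 hy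
    exact (hinv g y).1 ((hyA g).symm ▸ hg)

/-- A Borel map that is constant on orbits is constant on a residual set. -/
theorem exists_fiber_mem_residual [Countable G] [BaireSpace X] {x : X}
    (hx : Dense (orbit G x)) {Y : Type*} [MeasurableSpace Y] [StandardBorelSpace Y] {θ : X → Y}
    (hθ : @Measurable X Y (borel X) _ θ) (hinv : ∀ (g : G) (y : X), θ (g • y) = θ y) :
    ∃ y₀ : X, ∀ᶠ y in residual X, θ y = θ y₀ := by
  -- Coding `Y` into Cantor space reduces the claim to the zero-one law for each of countably many
  -- bits.
  obtain ⟨f, hf, hfinj⟩ := MeasurableSpace.measurable_injection_nat_bool_of_countablySeparated Y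
  have hpiece : ∀ n : ℕ, ∃ b : Bool, ∀ᶠ y in residual X, f (θ y) n = b := by
    intro n
    let A : Set X := {y | f (θ y) n = true}
    have hA : @MeasurableSet X (borel X) A := by
      have h1 : Measurable fun z : Y => f z n := (measurable_pi_apply n).comp hf
      exact hθ (h1 (measurableSet_singleton true))
    have hAB : BaireMeasurableSet A := by
      let _ := borel X
      have : BorelSpace X := ⟨rfl⟩
      exact MeasurableSet.baireMeasurableSet hA
    rcases mem_residual_or_compl_mem_residual hx hAB (fun g y => by simp [A, hinv]) with h | h
    · exact ⟨true, h⟩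
    · refine ⟨false, ?_⟩
      filter_upwards [h] with y hy
      simpa [A] using hy
  choose b hb using hpiece
  have hall : ∀ᶠ y in residual X, f (θ y) = b := by
    filter_upwards [eventually_countable_forall.2 hb] with y hy
    exact funext hy
  have : Nonempty X := ⟨x⟩
  obtain ⟨y₀, hy₀⟩ := (dense_of_mem_residual hall).nonempty
  refine ⟨y₀, ?_⟩
  filter_upwards [hall] with y hy
  exact hfinj (hy.trans hy₀.symm)

/-- If a point is an accumulation point of its own orbit, then the orbit equivalence relation of a
countable group acting by homeomorphisms on a compact Hausdorff space is not smooth. -/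
theorem not_isSmoothRel_of_mem_derivedSet_orbit {X : Type u} [TopologicalSpace X]
    [CompactSpace X] [T2Space X] [MulAction G X] [ContinuousConstSMul G X] [Countable G] {x : X}
    (hx : x ∈ derivedSet (orbit G x)) : ¬ IsSmoothRel.{u, v} (orbitRel G X) := by
  rintro ⟨Y, _, _, θ, hθ, hE⟩
  let K : SubMulAction G X :=
    ⟨closure (orbit G x), fun g y hy =>
      orbit_subset_closure_orbit (G := G) hy ⟨g, rfl⟩⟩
  have : CompactSpace K := isCompact_iff_compactSpace.1 (isClosed_closure (s := orbit G x)).isCompact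
  have : ContinuousConstSMul G K :=
    ⟨fun g => ((continuous_const_smul g).comp continuous_subtype_val).subtype_mk _⟩
  let x' : K := ⟨x, subset_closure (mem_orbit_self x)⟩
  have hval : ∀ g : G, ((g • x' : K) : X) = g • x := fun g => rfl
  have hdense : Dense (orbit G x') := by
    intro y
    rw [closure_subtype]
    have : (Subtype.val '' orbit G x' : Set X) = orbit G x := by
      ext z
      constructor
      · rintro ⟨_, ⟨g, rfl⟩, rfl⟩
        exact ⟨g, rfl⟩
      · rintro ⟨g, rfl⟩
        exact ⟨g • x', ⟨g, rfl⟩, rfl⟩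
    rw [this]
    exact y.2
  have hθ' : @Measurable K Y (borel K) _ (fun y => θ y) :=
    hθ.comp (continuous_subtype_val.borel_measurable)
  have hinv : ∀ (g : G) (y : K), θ ((g • y : K) : X) = θ y := by
    intro g y
    exact (hE _ _).1 ⟨g, rfl⟩
  obtain ⟨y₀, hy₀⟩ := exists_fiber_mem_residual hdense hθ' hinv
  have hcount : (orbit G y₀).Countable := countable_range _
  -- An isolated point of `K` would lie on the dense orbit, and translating it back would isolate
  -- `x'`, contrary to accumulation at `x`.
  have hnon : ∀ y : K, ({y}ᶜ : Set K) ∈ residual K := by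
    intro y
    refine residual_of_dense_open isOpen_compl_singleton ?_
    have hx'acc : ∀ g : G, ¬ IsOpen ({g • x'} : Set K) := by
      intro g hopen
      have hopen1 : IsOpen ({x'} : Set K) := by
        have := hopen.preimage (continuous_const_smul g)
        convert this using 1
        ext z
        simp
      obtain ⟨V, hV, hVeq⟩ := isOpen_induced_iff.1 hopen1
      have hxV : x ∈ V := by
        have : x' ∈ (Subtype.val ⁻¹' V : Set K) := by rw [hVeq]; rfl
        exact this
      obtain ⟨z, ⟨hzV, k, hk⟩, hzx⟩ := accPt_iff_nhds.1 hx V (hV.mem_nhds hxV)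
      have : (k • x' : K) ∈ (Subtype.val ⁻¹' V : Set K) := by
        change k • x ∈ V
        exact (show k • x = z from hk) ▸ hzV
      rw [hVeq] at this
      apply hzx
      rw [← hk]
      exact congrArg Subtype.val (show k • x' = x' from this)
    rw [dense_compl_singleton_iff_not_open]
    intro hopen
    obtain ⟨_, hz, ⟨g, rfl⟩⟩ := hdense.inter_open_nonempty {y} hopen ⟨y, rfl⟩
    rw [show y = g • x' from hz.symm] at hopen
    exact hx'acc g hopen
  have hcompl : ∀ᶠ y in residual K, y ∉ orbit G y₀ := by
    have := hcount.to_subtype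
    have : ∀ᶠ y : K in residual K, ∀ z : orbit G y₀, y ≠ z.1 :=
      eventually_countable_forall.2 fun z => hnon z
    filter_upwards [this] with y hy hmem
    exact hy ⟨y, hmem⟩ rfl
  have : Nonempty K := ⟨x'⟩
  obtain ⟨y, hy1, hy2⟩ := (dense_of_mem_residual (hy₀.and hcompl)).nonempty
  apply hy2
  obtain ⟨g, hg⟩ := (hE y y₀).2 hy1
  exact ⟨g, Subtype.ext hg⟩

end OrbitAccumulation

/-! ### The topology of the space of cones -/

namespace LO

variable {G : Type*} [Group G]

open MulAction Topology Set

theorem ext {P Q : LO G} (h : P.1 = Q.1) : P = Q := Subtype.ext h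

theorem mem_smul (g : G) (P : LO G) (x : G) : x ∈ (g • P).1 ↔ g⁻¹ * x * g ∈ P.1 := by
  constructor
  · rintro ⟨y, hy, rfl⟩
    simpa [mul_assoc] using hy
  · intro h
    exact ⟨_, h, by group⟩

theorem isInducing_boolIndicator :
    IsInducing (fun P : LO G => (Set.boolIndicator P.1 : G → Bool)) := ⟨rfl⟩

theorem isClopen_setOf_mem (x : G) : IsClopen {P : LO G | x ∈ P.1} := by
  have h : Continuous fun P : LO G => Set.boolIndicator P.1 x :=
    (continuous_apply x).comp isInducing_boolIndicator.continuous
  have : {P : LO G | x ∈ P.1} = (fun P : LO G => Set.boolIndicator P.1 x) ⁻¹' {true} := by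
    ext P
    exact Set.mem_iff_boolIndicator P.1 x
  rw [this]
  exact (isClopen_discrete {true}).preimage h

theorem isEmbedding_boolIndicator :
    IsEmbedding (fun P : LO G => (Set.boolIndicator P.1 : G → Bool)) := by
  refine ⟨isInducing_boolIndicator, fun P Q h => LO.ext ?_⟩
  ext x
  rw [Set.mem_iff_boolIndicator, Set.mem_iff_boolIndicator]
  exact Eq.congr_left (congrFun h x)

instance : T2Space (LO G) := isEmbedding_boolIndicator.t2Space

theorem continuous_iff_isClopen {Z : Type*} [TopologicalSpace Z] {f : Z → LO G} :
    Continuous f ↔ ∀ x : G, IsClopen {z | x ∈ (f z).1} := by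
  refine ⟨fun h x => (isClopen_setOf_mem x).preimage h, fun h => ?_⟩
  rw [isInducing_boolIndicator.continuous_iff]
  refine continuous_pi fun x => ?_
  exact (_root_.continuous_boolIndicator_iff_isClopen _).2 (h x)

instance : ContinuousConstSMul G (LO G) where
  continuous_const_smul g := by
    rw [continuous_iff_isClopen]
    intro x
    simp only [mem_smul]
    exact isClopen_setOf_mem _

end LO

/-! ### Elementary properties of positive cones -/

namespace IsPositiveCone

variable {G : Type*} [Group G] {P Q : Set G}

theorem mul_mem (hP : IsPositiveCone P) {x y : G} (hx : x ∈ P) (hy : y ∈ P) : x * y ∈ P :=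
  hP.mul_subset (Set.mul_mem_mul hx hy)

theorem inv_notMem (hP : IsPositiveCone P) {x : G} (hx : x ∈ P) : x⁻¹ ∉ P := fun h =>
  Set.disjoint_left.1 hP.disjoint_inv hx h

theorem one_notMem (hP : IsPositiveCone P) : (1 : G) ∉ P := fun h =>
  hP.inv_notMem h (by simpa using h)

theorem ne_one (hP : IsPositiveCone P) {x : G} (hx : x ∈ P) : x ≠ 1 := fun h =>
  hP.one_notMem (h ▸ hx)

theorem mem_or_inv_mem (hP : IsPositiveCone P) {x : G} (hx : x ≠ 1) : x ∈ P ∨ x⁻¹ ∈ P := by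
  have : x ∈ P ∪ P⁻¹ := by rw [hP.union_inv]; exact hx
  exact this

theorem inv_mem_of_notMem (hP : IsPositiveCone P) {x : G} (hx : x ≠ 1) (h : x ∉ P) : x⁻¹ ∈ P :=
  (hP.mem_or_inv_mem hx).resolve_left h

theorem trichotomy (hP : IsPositiveCone P) (x : G) : x ∈ P ∨ x = 1 ∨ x⁻¹ ∈ P := by
  by_cases h : x = 1
  · exact Or.inr (Or.inl h)
  · exact (hP.mem_or_inv_mem h).imp_right Or.inr

theorem of_forall (hmul : ∀ x ∈ P, ∀ y ∈ P, x * y ∈ P) (h1 : (1 : G) ∉ P)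
    (htot : ∀ x : G, x ≠ 1 → x ∈ P ∨ x⁻¹ ∈ P) : IsPositiveCone P where
  mul_subset := by
    rintro _ ⟨x, hx, y, hy, rfl⟩
    exact hmul x hx y hy
  disjoint_inv := by
    rw [Set.disjoint_left]
    intro x hx hx'
    exact h1 (by simpa using hmul x hx _ hx')
  union_inv := by
    ext x
    refine ⟨?_, htot x⟩
    rintro (h | h) (rfl : x = 1)
    · exact h1 h
    · exact h1 (by simpa using h)

/-- Totality makes cones maximal, so equality of cones only ever needs one inclusion. -/
theorem eq_of_subset (hP : IsPositiveCone P) (hQ : IsPositiveCone Q) (h : P ⊆ Q) : P = Q := by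
  refine h.antisymm fun x hx => ?_
  by_contra hxP
  exact hQ.inv_notMem hx (h (hP.inv_mem_of_notMem (hQ.ne_one hx) hxP))

theorem inv (hP : IsPositiveCone P) : IsPositiveCone P⁻¹ := by
  refine of_forall (fun x hx y hy => ?_) ?_ ?_
  · simpa using hP.mul_mem hy hx
  · simpa using hP.one_notMem
  · intro x hx
    simpa [or_comm] using hP.mem_or_inv_mem hx

theorem pow_mem (hP : IsPositiveCone P) {x : G} (hx : x ∈ P) {n : ℕ} (hn : n ≠ 0) : x ^ n ∈ P := by
  induction n with
  | zero => exact absurd rfl hn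
  | succ k ih =>
    rcases eq_or_ne k 0 with rfl | hk
    · simpa using hx
    · rw [pow_succ]
      exact hP.mul_mem (ih hk) hx

theorem pow_eq_one (hP : IsPositiveCone P) {x : G} {n : ℕ} (hn : n ≠ 0) (h : x ^ n = 1) :
    x = 1 := by
  rcases hP.trichotomy x with hx | hx | hx
  · exact absurd h (hP.ne_one (hP.pow_mem hx hn))
  · exact hx
  · exact absurd (by simp [h]) (hP.ne_one (hP.pow_mem hx hn))

/-- The preimage of a positive cone under an injective homomorphism is a positive cone. -/
theorem preimage {H : Type*} [Group H] (hP : IsPositiveCone P) {f : H →* G}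
    (hf : Function.Injective f) : IsPositiveCone (f ⁻¹' P) := by
  refine of_forall (fun x hx y hy => ?_) ?_ ?_
  · simpa using hP.mul_mem hx hy
  · simpa using hP.one_notMem
  · intro x hx
    have : f x ≠ 1 := fun h => hx (hf (h.trans f.map_one.symm))
    simpa using hP.mem_or_inv_mem this

end IsPositiveCone

/-! ### Compactness and basic neighbourhoods -/

namespace LO

variable {G : Type*} [Group G]

open MulAction Topology Set

/-- Each cone axiom constrains finitely many coordinates at a time, so the cones form a closed
subset of the compact space `G → Bool`. -/
instance : CompactSpace (LO G) := by
  refine IsClosedEmbedding.compactSpace (f := fun P : LO G => (Set.boolIndicator P.1 : G → Bool))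
    ⟨isEmbedding_boolIndicator, ?_⟩
  have hrange : range (fun P : LO G => (Set.boolIndicator P.1 : G → Bool)) =
      {f | ∀ x y, f x = true → f y = true → f (x * y) = true} ∩ {f | f 1 = false} ∩
        {f | ∀ x, x ≠ 1 → f x = true ∨ f x⁻¹ = true} := by
    ext f
    constructor
    · rintro ⟨P, rfl⟩
      simp only [mem_inter_iff, mem_ofPred_eq, ← Set.mem_iff_boolIndicator,
        ← Set.notMem_iff_boolIndicator]
      exact ⟨⟨fun x y hx hy => P.2.mul_mem hx hy, P.2.one_notMem⟩,
        fun x hx => P.2.mem_or_inv_mem hx⟩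
    · rintro ⟨⟨hmul, h1⟩, htot⟩
      refine ⟨⟨{x | f x = true}, IsPositiveCone.of_forall (fun x hx y hy => hmul x y hx hy)
        (by simpa using h1) htot⟩, ?_⟩
      funext x
      by_cases hx : f x = true
      · rw [hx]
        exact (Set.mem_iff_boolIndicator _ _).1 hx
      · rw [Bool.not_eq_true] at hx
        rw [hx]
        exact (Set.notMem_iff_boolIndicator _ _).1 (by simp [hx])
  rw [hrange]
  have hcl : ∀ (x : G) (b : Bool), IsClopen {f : G → Bool | f x = b} := fun x b =>
    (isClopen_discrete {b}).preimage (continuous_apply x)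
  refine ((?_ : IsClosed _).inter (hcl 1 false).1).inter ?_
  · simp only [ofPred_forall, imp_iff_not_or, ofPred_or]
    exact isClosed_iInter fun x => isClosed_iInter fun y =>
      (hcl x true).compl.1.union ((hcl y true).compl.1.union (hcl _ true).1)
  · simp only [ofPred_forall, ofPred_or]
    exact isClosed_iInter fun x => isClosed_iInter fun _ => (hcl x true).1.union (hcl _ true).1

theorem isClopen_setOf_subset (S : Finset G) : IsClopen {P : LO G | ↑S ⊆ P.1} := by
  have : {P : LO G | ↑S ⊆ P.1} = ⋂ x ∈ S, {P : LO G | x ∈ P.1} := by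
    ext P
    simp [Set.subset_def]
  rw [this]
  exact isClopen_biInter_finset fun x _ => isClopen_setOf_mem x

/-- The cones containing a given finite set of positive elements form a neighbourhood basis. -/
theorem exists_finset_of_isOpen {U : Set (LO G)} (hU : IsOpen U) {P : LO G} (hP : P ∈ U) :
    ∃ S : Finset G, ↑S ⊆ P.1 ∧ ∀ Q : LO G, ↑S ⊆ Q.1 → Q ∈ U := by
  have hsub : (⋂ S : {S : Finset G // ↑S ⊆ P.1}, {Q : LO G | ↑S.1 ⊆ Q.1}) ⊆ U := by
    intro Q hQ
    rw [mem_iInter] at hQ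
    have : P = Q := LO.ext (P.2.eq_of_subset Q.2 fun x hx => by
      have := hQ ⟨{x}, by simpa using hx⟩
      simpa using this)
    exact this ▸ hP
  classical
  have hne : Nonempty {S : Finset G // ↑S ⊆ P.1} := ⟨⟨∅, by simp⟩⟩
  obtain ⟨S, hS⟩ := exists_subset_nhds_of_isCompact
    (V := fun S : {S : Finset G // ↑S ⊆ P.1} => {Q : LO G | ↑S.1 ⊆ Q.1})
    (fun S T => ⟨⟨S.1 ∪ T.1, by simpa using ⟨S.2, T.2⟩⟩,
      fun Q hQ => by
        have : (↑(S.1 ∪ T.1) : Set G) ⊆ Q.1 := hQ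
        rw [Finset.coe_union, union_subset_iff] at this
        exact this.1,
      fun Q hQ => by
        have : (↑(S.1 ∪ T.1) : Set G) ⊆ Q.1 := hQ
        rw [Finset.coe_union, union_subset_iff] at this
        exact this.2⟩)
    (fun S => (isClopen_setOf_subset S.1).1.isCompact)
    (fun Q hQ => hU.mem_nhds (hsub hQ))
  exact ⟨S.1, S.2, fun Q hQ => hS hQ⟩

end LO

/-! ### Condensed and isolated cones in terms of finite sets -/

/-- A positive cone that is a limit of other cones in its conjugacy orbit. -/
def IsCondensed {G : Type*} [Group G] (Q : Set G) : Prop :=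
  ∀ T : Finset G, ↑T ⊆ Q → ∃ g : G, (∀ x ∈ T, g⁻¹ * x * g ∈ Q) ∧ ∃ x ∈ Q, g⁻¹ * x * g ∉ Q

/-- A positive cone `P` is isolated by a finite set `S` if it is the only cone containing `S`. -/
structure IsolatedBy {G : Type*} [Group G] (P : Set G) (S : Finset G) : Prop where
  cone : IsPositiveCone P
  subset : ↑S ⊆ P
  eq_of_subset : ∀ Q : Set G, IsPositiveCone Q → ↑S ⊆ Q → Q = P

namespace LO

variable {G : Type*} [Group G]

open MulAction Topology Set

theorem mem_derivedSet_orbit_iff (P : LO G) :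
    P ∈ derivedSet (orbit G P) ↔ IsCondensed P.1 := by
  rw [mem_derivedSet, accPt_iff_nhds]
  constructor
  · intro h T hT
    obtain ⟨_, ⟨hQ, g, rfl⟩, hne⟩ := h _ ((isClopen_setOf_subset T).2.mem_nhds hT)
    refine ⟨g, fun x hx => (mem_smul g P x).1 (hQ hx), ?_⟩
    by_contra! hcon
    exact hne (LO.ext (P.2.eq_of_subset (g • P).2
      fun x hx => (mem_smul g P x).2 (hcon x hx)).symm)
  · intro h U hU
    obtain ⟨V, hVU, hV, hPV⟩ := mem_nhds_iff.1 hU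
    obtain ⟨S, hS, hSV⟩ := exists_finset_of_isOpen hV hPV
    obtain ⟨g, hg, x, hx, hxg⟩ := h S hS
    refine ⟨g • P, ⟨hVU (hSV _ fun y hy => (mem_smul g P y).2 (hg y hy)), g, rfl⟩, ?_⟩
    intro heq
    exact hxg ((mem_smul g P x).1 (heq.symm ▸ hx))

theorem exists_isolatedBy {P : LO G} (h : IsOpen ({P} : Set (LO G))) :
    ∃ S, IsolatedBy P.1 S := by
  obtain ⟨S, hS, hSP⟩ := exists_finset_of_isOpen h (mem_singleton P)
  exact ⟨S, P.2, hS, fun Q hQ hSQ => congrArg Subtype.val (hSP ⟨Q, hQ⟩ hSQ)⟩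

theorem not_isSmoothRel_of_isCondensed {G : Type u} [Group G] [Countable G] {P : Set G}
    (hP : IsPositiveCone P) (hc : IsCondensed P) : ¬ IsSmoothRel.{u, v} (Elo G) :=
  not_isSmoothRel_of_mem_derivedSet_orbit ((mem_derivedSet_orbit_iff ⟨P, hP⟩).2 hc)

end LO

/-! ### Primitive order-preserving actions -/

section OrderedAction

variable {G Ω : Type*} [Group G] [LinearOrder Ω] [MulAction G Ω]

open MulAction

/-- A point of an ordered `G`-set is primitive if the only subgroup with convex orbit of the point
and not fixing the point is the whole group. -/
def IsOrderPrimitiveAt (G : Type*) {Ω : Type*} [Group G] [LinearOrder Ω] [MulAction G Ω]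
    (β : Ω) : Prop :=
  ∀ D : Subgroup G, (∀ g h : G, h ∈ D → β ≤ g • β → g • β ≤ h • β → g ∈ D) →
    (∃ g ∈ D, g • β ≠ β) → D = ⊤

/-- No group element moves a point of `X` up and another point of `X` down. -/
def IsMonotoneOn (G : Type*) {Ω : Type*} [Group G] [LinearOrder Ω] [MulAction G Ω]
    (X : Set Ω) : Prop :=
  ∀ α ∈ X, ∀ β ∈ X, ∀ t : G, α < t • α → β ≤ t • β

/-- The action on `Ω` is by order automorphisms. -/
def IsOrderedAction (G Ω : Type*) [Group G] [LinearOrder Ω] [MulAction G Ω] : Prop :=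
  ∀ (g : G) (α β : Ω), α < β → g • α < g • β

namespace IsOrderedAction

variable (hG : IsOrderedAction G Ω) {α β ω₀ : Ω}
include hG

theorem smul_lt_smul_iff (g : G) : g • α < g • β ↔ α < β :=
  ⟨fun h => by simpa using hG g⁻¹ _ _ h, hG g _ _⟩

theorem smul_le_smul_iff (g : G) : g • α ≤ g • β ↔ α ≤ β := by
  rw [← not_lt, ← not_lt, hG.smul_lt_smul_iff]

theorem lt_inv_smul_iff (g : G) : α < g⁻¹ • β ↔ g • α < β := by
  rw [← hG.smul_lt_smul_iff g, smul_inv_smul]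

theorem inv_smul_lt_iff (g : G) : g⁻¹ • α < β ↔ α < g • β := by
  rw [← hG.smul_lt_smul_iff g, smul_inv_smul]

theorem inv_smul_le_iff (g : G) : g⁻¹ • α ≤ β ↔ α ≤ g • β := by
  rw [← hG.smul_le_smul_iff g, smul_inv_smul]

theorem le_inv_smul_iff (g : G) : α ≤ g⁻¹ • β ↔ g • α ≤ β := by
  rw [← hG.smul_le_smul_iff g, smul_inv_smul]

theorem conj_lt_iff (g t : G) : g⁻¹ • α < (g⁻¹ * t * g) • (g⁻¹ • α) ↔ α < t • α := by
  rw [mul_smul, mul_smul, smul_inv_smul, hG.smul_lt_smul_iff]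

theorem conj_le_iff (g t : G) : g⁻¹ • α ≤ (g⁻¹ * t * g) • (g⁻¹ • α) ↔ α ≤ t • α := by
  rw [mul_smul, mul_smul, smul_inv_smul, hG.smul_le_smul_iff]

theorem isMonotoneOn_le {X : Set Ω} (hX : IsMonotoneOn G X) (hα : α ∈ X) (hβ : β ∈ X) {t : G}
    (h : t • α < α) : t • β ≤ β :=
  (hG.le_inv_smul_iff t).1 (hX α hα β hβ t⁻¹ ((hG.lt_inv_smul_iff t).2 h))

theorem zpow_smul_lt_smul {p : G} (hp : β < p • β) {m n : ℤ} (h : m < n) :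
    p ^ m • β < p ^ n • β := by
  have hnat : ∀ k : ℕ, β < p ^ (k + 1) • β := by
    intro k
    induction k with
    | zero => simpa using hp
    | succ k ih =>
      rw [pow_succ', mul_smul]
      exact hp.trans (hG p _ _ ih)
  obtain ⟨k, hk⟩ := Int.eq_ofNat_of_zero_le (show 0 ≤ n - m - 1 by omega)
  have : n = m + ((k + 1 : ℕ) : ℤ) := by push_cast; omega
  rw [this, zpow_add, mul_smul, zpow_natCast]
  exact hG _ _ _ (hnat k)

/-- If `p` moves a primitive point `β` up, and no element of the group moves points of the
`p`-orbit of `β` in different directions, then the `p`-orbit of `β` is unbounded in the orbit. -/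
theorem exists_zpow_bounds (hprim : IsOrderPrimitiveAt G β) {p : G} (hp : β < p • β)
    (hX : IsMonotoneOn G (Set.range fun n : ℤ => p ^ n • β)) (g : G) :
    ∃ n : ℕ, p ^ (-n : ℤ) • β < g • β ∧ g • β < p ^ (n : ℤ) • β := by
  have hmem : ∀ n : ℤ, p ^ n • β ∈ Set.range fun n : ℤ => p ^ n • β := fun n => ⟨n, rfl⟩
  have hβ : β ∈ Set.range fun n : ℤ => p ^ n • β := ⟨0, by simp⟩
  -- Both `up` and `down` apply monotonicity to `p ^ (-n) * t`, which moves `β` in a known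
  -- direction.
  have up : ∀ (t : G) (n m k : ℤ), p ^ n • β < t • β → k = n + m → p ^ k • β ≤ t • p ^ m • β := by
    intro t n m k h hk
    have h1 : β < (p ^ (-n) * t) • β := by
      rw [zpow_neg, mul_smul, hG.lt_inv_smul_iff]
      exact h
    have h2 := hX β hβ _ (hmem m) _ h1
    rw [zpow_neg, mul_smul, hG.le_inv_smul_iff, ← mul_smul, ← zpow_add] at h2
    rwa [hk]
  have down : ∀ (t : G) (n m k : ℤ), t • β < p ^ n • β → k = n + m → t • p ^ m • β ≤ p ^ k • β := by
    intro t n m k h hk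
    have h1 : (p ^ (-n) * t) • β < β := by
      rw [zpow_neg, mul_smul, hG.inv_smul_lt_iff]
      exact h
    have h2 := hG.isMonotoneOn_le hX hβ (hmem m) h1
    rw [zpow_neg, mul_smul, hG.inv_smul_le_iff] at h2
    rwa [hk, zpow_add, mul_smul]
  -- The elements keeping `β` within the range of its `p`-orbit form a subgroup with convex orbit;
  -- it contains `p`, so primitivity makes it everything.
  let D : Subgroup G :=
    { carrier := {g | ∃ n : ℕ, p ^ (-n : ℤ) • β < g • β ∧ g • β < p ^ (n : ℤ) • β}
      one_mem' := ⟨1, by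
        have h1 := hG.zpow_smul_lt_smul hp (show (-(1 : ℕ) : ℤ) < 0 by norm_num)
        have h2 := hG.zpow_smul_lt_smul hp (show (0 : ℤ) < (1 : ℕ) by norm_num)
        simp only [zpow_zero] at h1 h2
        exact ⟨h1, h2⟩⟩
      mul_mem' := by
        rintro g h ⟨n, hn1, hn2⟩ ⟨m, hm1, hm2⟩
        refine ⟨n + m, ?_, ?_⟩
        · rw [mul_smul]
          exact (up g (-n) (-m) _ hn1 (by push_cast; ring)).trans_lt (hG g _ _ hm1)
        · rw [mul_smul]
          exact (hG g _ _ hm2).trans_le (down g n m _ hn2 (by push_cast; ring))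
      inv_mem' := by
        rintro g ⟨n, hn1, hn2⟩
        -- `up` and `down` give weak inequalities; the extra power makes them strict.
        refine ⟨n + 1, ?_, ?_⟩
        · rw [hG.lt_inv_smul_iff]
          have := down g n (-(n + 1 : ℕ)) (-1) hn2 (by push_cast; ring)
          refine this.trans_lt ?_
          simpa using hG.zpow_smul_lt_smul hp (show (-1 : ℤ) < 0 by norm_num)
        · rw [hG.inv_smul_lt_iff]
          have := up g (-n) ((n + 1 : ℕ)) 1 hn1 (by push_cast; ring)
          refine lt_of_lt_of_le ?_ this
          simpa using hp }
  have hD : D = ⊤ := by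
    refine hprim D ?_ ⟨p, ⟨2, ?_, ?_⟩, hp.ne'⟩
    · rintro g h ⟨n, -, hn2⟩ h1 h2
      refine ⟨n + 1, ?_, ?_⟩
      · refine lt_of_lt_of_le ?_ h1
        simpa using hG.zpow_smul_lt_smul hp (show (-(n + 1 : ℕ) : ℤ) < 0 by push_cast; omega)
      · exact (h2.trans_lt hn2).trans (hG.zpow_smul_lt_smul hp (by push_cast; omega))
    · simpa using hG.zpow_smul_lt_smul hp (show (-(2 : ℕ) : ℤ) < 1 by norm_num)
    · simpa using hG.zpow_smul_lt_smul hp (show (1 : ℤ) < (2 : ℕ) by norm_num)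
  exact (hD ▸ Subgroup.mem_top g : g ∈ D)

/-- Transitivity carries the left end `ω₀` to any `α` in the interval by some `g`. The hypothesis
applied to `g` itself shows that `g` does not lower `s • ω₀`, so points to the right of `α` pull
back into the original interval and `t` may be replaced by its conjugate. -/
theorem isMonotoneOn_Icc [IsPretransitive G Ω] {s : G}
    (hs : ∀ ω, ω₀ ≤ ω → ω < s • ω₀ → ∀ t : G, ω₀ < t • ω₀ → ω ≤ t • ω) :
    IsMonotoneOn G (Set.Icc ω₀ (s • ω₀)) := by
  have key : ∀ α β, ω₀ ≤ α → α ≤ β → β < s • ω₀ → ∀ t : G, α < t • α → β ≤ t • β := by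
    intro α β hα hαβ hβ t ht
    rcases hα.eq_or_lt with rfl | hα'
    · exact hs β hαβ hβ t ht
    obtain ⟨g, rfl⟩ := exists_smul_eq G ω₀ α
    have hgs : s • ω₀ ≤ g • s • ω₀ := by
      by_contra! hlt
      have h1 : ω₀ ≤ g • s • ω₀ :=
        hα.trans ((hG.smul_le_smul_iff g).2 (hα.trans (hαβ.trans hβ.le)))
      exact (hG g _ _ hlt).not_ge (hs _ h1 hlt g hα')
    have h2 : ω₀ ≤ g⁻¹ • β := (hG.le_inv_smul_iff g).2 hαβ
    have h3 : g⁻¹ • β < s • ω₀ := (hG.inv_smul_lt_iff g).2 (hβ.trans_le hgs)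
    have h4 := hs _ h2 h3 (g⁻¹ * t * g) (by simpa using (hG.conj_lt_iff g t).2 ht)
    exact (hG.conj_le_iff g t).1 h4
  have key2 : ∀ α β, ω₀ ≤ α → α ≤ β → β ≤ s • ω₀ → ∀ t : G, α < t • α → β ≤ t • β := by
    intro α β hα hαβ hβ t ht
    rcases hβ.lt_or_eq with hβ' | rfl
    · exact key α β hα hαβ hβ' t ht
    by_contra! hlt
    have h1 : α < t • s • ω₀ := ht.trans_le ((hG.smul_le_smul_iff t).2 hαβ)
    exact (hG t _ _ hlt).not_ge (key α _ hα h1.le hlt t ht)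
  rintro α ⟨hα1, hα2⟩ β ⟨hβ1, hβ2⟩ t ht
  rcases le_total α β with h | h
  · exact key2 α β hα1 h hβ2 t ht
  · by_contra! hlt
    have h1 := key2 β α hβ1 h hα2 t⁻¹ ((hG.lt_inv_smul_iff t).2 hlt)
    rw [hG.le_inv_smul_iff] at h1
    exact ht.not_ge h1

/-- If `p` moved `β` up, powers of `p` would bring any two points of the `p`-orbit of `β` between
`α` and `β`, making that orbit monotone. By primitivity it would then be unbounded, yet the fixed
point `α` bounds it on one side. -/
theorem smul_eq_of_isMonotoneOn [IsPretransitive G Ω] (hprim : ∀ ω : Ω, IsOrderPrimitiveAt G ω)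
    {I : Set Ω} [I.OrdConnected] (hI : IsMonotoneOn G I) (hα : α ∈ I) (hβ : β ∈ I) {p : G}
    (hp : p • α = α) : p • β = β := by
  have key : ∀ p : G, p • α = α → p • β ≤ β := by
    intro p hp
    by_contra! hlt
    have hfix : ∀ n : ℤ, p ^ n • α = α := fun n =>
      (zpow_mem (K := stabilizer G α) hp n : p ^ n ∈ stabilizer G α)
    have htr : ∀ k m n : ℤ, p ^ (-k) • p ^ n • β ∈ I → p ^ (-k) • p ^ m • β ∈ I → ∀ t : G,
        p ^ m • β < t • p ^ m • β → p ^ n • β ≤ t • p ^ n • β := by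
      intro k m n h1 h2 t ht
      rw [zpow_neg] at h1 h2
      exact (hG.conj_le_iff (p ^ k) t).1 (hI _ h2 _ h1 _ ((hG.conj_lt_iff (p ^ k) t).2 ht))
    have hmon : ∀ m n : ℤ, m ≤ n → p ^ m • β ≤ p ^ n • β := by
      intro m n h
      rcases h.lt_or_eq with h | rfl
      · exact (hG.zpow_smul_lt_smul hlt h).le
      · exact le_rfl
    have hX : IsMonotoneOn G (Set.range fun n : ℤ => p ^ n • β) := by
      rintro _ ⟨m, rfl⟩ _ ⟨n, rfl⟩ t ht
      have hmem : ∀ j : ℤ, (α ≤ β → j ≤ 0) → (β ≤ α → 0 ≤ j) → p ^ j • β ∈ I := by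
        intro j h1 h2
        rcases le_total α β with h | h
        · refine Set.Icc_subset I hα hβ ⟨?_, by simpa using hmon j 0 (h1 h)⟩
          rw [← hfix j, hG.smul_le_smul_iff]
          exact h
        · refine Set.Icc_subset I hβ hα ⟨by simpa using hmon 0 j (h2 h), ?_⟩
          conv_rhs => rw [← hfix j]
          rw [hG.smul_le_smul_iff]
          exact h
      have hne : α ≠ β := by
        rintro rfl
        exact hlt.ne' hp
      rcases hne.lt_or_gt with h | h
      · refine htr (max m n) m n ?_ ?_ t ht <;> rw [← mul_smul, ← zpow_add] <;>
          refine hmem _ (fun _ => ?_) (fun h' => absurd h h'.not_gt) <;> omega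
      · refine htr (min m n) m n ?_ ?_ t ht <;> rw [← mul_smul, ← zpow_add] <;>
          refine hmem _ (fun h' => absurd h h'.not_gt) (fun _ => ?_) <;> omega
    obtain ⟨g, hg⟩ := exists_smul_eq G β α
    obtain ⟨n, h1, h2⟩ := hG.exists_zpow_bounds (hprim β) hlt hX g
    rw [hg] at h1 h2
    rw [← hfix (-n), hG.smul_lt_smul_iff] at h1
    rw [← hfix n, hG.smul_lt_smul_iff] at h2
    exact lt_asymm h1 h2
  refine (key p hp).antisymm ?_
  rw [← hG.inv_smul_le_iff]
  exact key p⁻¹ (by rw [inv_smul_eq_iff, hp])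

/-- In a primitive transitive ordered action, either arbitrarily close to the right of `ω₀` there
is a point moved down by an element that moves `ω₀` up, or an element that moves one point up moves
every point up. -/
theorem lt_smul_of_forall_le_smul [IsPretransitive G Ω]
    (hprim : ∀ ω : Ω, IsOrderPrimitiveAt G ω) {s : G} (hs₀ : ω₀ < s • ω₀)
    (hs : ∀ ω, ω₀ ≤ ω → ω < s • ω₀ → ∀ t : G, ω₀ < t • ω₀ → ω ≤ t • ω) {t : G}
    (h : α < t • α) : β < t • β := by
  have hI := hG.isMonotoneOn_Icc hs
  have hstrict : ∀ α ∈ Set.Icc ω₀ (s • ω₀), ∀ β ∈ Set.Icc ω₀ (s • ω₀), ∀ t : G,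
      α < t • α → β < t • β := by
    intro α hα β hβ t ht
    refine lt_of_le_of_ne (hI α hα β hβ t ht) fun heq => ?_
    exact ht.ne' (hG.smul_eq_of_isMonotoneOn hprim hI hβ hα heq.symm)
  -- `D` collects the `g` such that every point between `ω₀` and `g • ω₀` is moved up by exactly the
  -- same elements as `ω₀`. It has convex orbit and contains `s`, so primitivity applies.
  let D : Subgroup G :=
    { carrier := {g | ∀ ξ ∈ Set.uIcc ω₀ (g • ω₀), ∀ t : G, ω₀ < t • ω₀ ↔ ξ < t • ξ}
      one_mem' := by
        intro ξ hξ t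
        rw [one_smul, Set.uIcc_self, Set.mem_singleton_iff] at hξ
        rw [hξ]
      mul_mem' := by
        intro g h hg hh ξ hξ t
        rcases Set.uIcc_subset_uIcc_union_uIcc (b := g • ω₀) hξ with h1 | h1
        · exact hg ξ h1 t
        · have h2 : g⁻¹ • ξ ∈ Set.uIcc ω₀ (h • ω₀) := by
            rw [mul_smul, Set.mem_uIcc] at h1
            rw [Set.mem_uIcc, hG.le_inv_smul_iff, hG.le_inv_smul_iff, hG.inv_smul_le_iff,
              hG.inv_smul_le_iff]
            exact h1
          rw [hg _ Set.right_mem_uIcc t, ← hG.conj_lt_iff g, inv_smul_smul, hh _ h2,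
            hG.conj_lt_iff g]
      inv_mem' := by
        intro g hg ξ hξ t
        have h2 : g • ξ ∈ Set.uIcc ω₀ (g • ω₀) := by
          rw [Set.mem_uIcc] at hξ ⊢
          rw [hG.smul_le_smul_iff, hG.smul_le_smul_iff, ← hG.inv_smul_le_iff g,
            ← hG.le_inv_smul_iff g]
          exact hξ.symm
        have h3 := hg _ h2 (g * t * g⁻¹)
        have h4 := hg _ Set.right_mem_uIcc (g * t * g⁻¹)
        have h5 : ∀ η : Ω, g • η < (g * t * g⁻¹) • g • η ↔ η < t • η := by
          intro η
          simpa [mul_assoc] using hG.conj_lt_iff (α := g • η) g (g * t * g⁻¹) |>.symm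
        rw [h5] at h3 h4
        exact h4.symm.trans h3 }
  have hD : D = ⊤ := by
    refine hprim ω₀ D ?_ ⟨s, ?_, hs₀.ne'⟩
    · intro g k hk h1 h2 ξ hξ
      refine hk ξ (Set.uIcc_subset_uIcc Set.left_mem_uIcc ?_ hξ)
      exact Set.mem_uIcc.2 (Or.inl ⟨h1, h2⟩)
    · intro ξ hξ t
      rw [Set.uIcc_of_le hs₀.le] at hξ
      have h0 : ω₀ ∈ Set.Icc ω₀ (s • ω₀) := ⟨le_rfl, hs₀.le⟩
      exact ⟨hstrict _ h0 _ hξ t, hstrict _ hξ _ h0 t⟩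
  have hall : ∀ ξ : Ω, ω₀ < t • ω₀ ↔ ξ < t • ξ := by
    intro ξ
    obtain ⟨g, rfl⟩ := exists_smul_eq G ω₀ ξ
    exact (hD ▸ Subgroup.mem_top g : g ∈ D) _ Set.right_mem_uIcc t
  exact (hall β).1 ((hall α).2 h)

end IsOrderedAction

end OrderedAction

/-! ### Convex subgroups, their coset orders, and condensed cones -/

/-- A subgroup is convex for the left-ordering with positive cone `P` if it contains every positive
element that lies below an element of the subgroup. -/
def IsConvexFor {G : Type*} [Group G] (P : Set G) (C : Subgroup G) : Prop :=
  ∀ x ∈ P, ∀ y ∈ P, x * y ∈ C → x ∈ C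

namespace IsConvexFor

variable {G : Type*} [Group G] {P : Set G} {C D : Subgroup G}

theorem mul_mem_left (hC : IsConvexFor P C) (hP : IsPositiveCone P) {p c : G} (hp : p ∈ P)
    (hpC : p ∉ C) (hc : c ∈ C) : c * p ∈ P := by
  have h1 : c * p ≠ 1 := fun h => hpC (by
    rw [← C.mul_mem_cancel_left hc, h]
    exact C.one_mem)
  by_contra hcon
  have h2 := hP.inv_mem_of_notMem h1 hcon
  exact hpC (hC p hp _ h2 (by simpa using hc))

theorem mul_mem_right (hC : IsConvexFor P C) (hP : IsPositiveCone P) {p c : G} (hp : p ∈ P)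
    (hpC : p ∉ C) (hc : c ∈ C) : p * c ∈ P := by
  have h1 : p * c ≠ 1 := fun h => hpC (by
    rw [← C.mul_mem_cancel_right hc, h]
    exact C.one_mem)
  by_contra hcon
  have h2 := hP.inv_mem_of_notMem h1 hcon
  have h3 := hC _ h2 p hp (by simpa using hc)
  exact hpC ((C.mul_mem_cancel_right hc).1 (by simpa using C.inv_mem h3))

theorem notMem_mul (hC : IsConvexFor P C) {p q : G} (hp : p ∈ P)
    (hpC : p ∉ C) (hq : q ∈ P) : p * q ∉ C := fun h => hpC (hC p hp q hq h)

theorem notMem_mul' (hC : IsConvexFor P C) {p q : G} (hp : p ∈ P)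
    (hq : q ∈ P) (hqC : q ∉ C) : p * q ∉ C := fun h =>
  hqC ((C.mul_mem_cancel_left (hC p hp q hq h)).1 h)

/-- Of two positive elements, each witnessing one failed inclusion, the smaller lies in both convex
subgroups. -/
theorem le_or_le (hC : IsConvexFor P C) (hD : IsConvexFor P D) (hP : IsPositiveCone P) :
    C ≤ D ∨ D ≤ C := by
  have hpos : ∀ A B : Subgroup G, ¬ A ≤ B → ∃ a ∈ P, a ∈ A ∧ a ∉ B := by
    intro A B h
    obtain ⟨a, ha, hb⟩ := SetLike.not_le_iff_exists.1 h
    rcases hP.trichotomy a with h1 | rfl | h1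
    · exact ⟨a, h1, ha, hb⟩
    · exact absurd B.one_mem hb
    · exact ⟨a⁻¹, h1, A.inv_mem ha, fun h => hb (by simpa using B.inv_mem h)⟩
  by_contra! hcon
  obtain ⟨c, hcP, hc, hcD⟩ := hpos _ _ hcon.1
  obtain ⟨d, hdP, hd, hdC⟩ := hpos _ _ hcon.2
  rcases hP.trichotomy (c⁻¹ * d) with h | h | h
  · exact hcD (hD c hcP _ h (by simpa using hd))
  · exact hcD (by rwa [inv_mul_eq_one.1 h])
  · exact hdC (hC d hdP _ h (by simpa using hc))

theorem bot (hP : IsPositiveCone P) : IsConvexFor P ⊥ := by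
  intro x hx y hy h
  exact absurd (Subgroup.mem_bot.1 h) (hP.ne_one (hP.mul_mem hx hy))

theorem mem_of_pow_mem (hC : IsConvexFor P C) (hP : IsPositiveCone P) {x : G} {n : ℕ}
    (hn : n ≠ 0) (h : x ^ n ∈ C) : x ∈ C := by
  have key : ∀ y ∈ P, y ^ n ∈ C → y ∈ C := by
    intro y hy h
    obtain ⟨k, rfl⟩ := Nat.exists_eq_succ_of_ne_zero hn
    rcases eq_or_ne k 0 with rfl | hk
    · simpa using h
    · exact hC y hy _ (hP.pow_mem hy hk) (by rwa [← pow_succ'])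
  rcases hP.trichotomy x with hx | rfl | hx
  · exact key x hx h
  · exact C.one_mem
  · simpa using key x⁻¹ hx (by simpa using h)

open Classical in
/-- The order on the left cosets of a convex subgroup. -/
@[reducible] noncomputable def cosetLinearOrder (hC : IsConvexFor P C) (hP : IsPositiveCone P) :
    LinearOrder (G ⧸ C) where
  le x y := ∀ g h : G, (g : G ⧸ C) = x → (h : G ⧸ C) = y → g⁻¹ * h ∈ C ∨ g⁻¹ * h ∈ P
  le_refl x g h hg hh := Or.inl (QuotientGroup.eq.1 (hg.trans hh.symm))
  le_trans x y z hxy hyz g k hg hk := by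
    obtain ⟨h, rfl⟩ := QuotientGroup.mk_surjective y
    have e : g⁻¹ * k = (g⁻¹ * h) * (h⁻¹ * k) := by group
    rw [e]
    by_cases h1 : g⁻¹ * h ∈ C <;> by_cases h2 : h⁻¹ * k ∈ C
    · exact Or.inl (C.mul_mem h1 h2)
    · exact Or.inr (hC.mul_mem_left hP ((hyz h k rfl hk).resolve_left h2) h2 h1)
    · exact Or.inr (hC.mul_mem_right hP ((hxy g h hg rfl).resolve_left h1) h1 h2)
    · exact Or.inr (hP.mul_mem ((hxy g h hg rfl).resolve_left h1)
        ((hyz h k rfl hk).resolve_left h2))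
  le_antisymm x y hxy hyx := by
    obtain ⟨g, rfl⟩ := QuotientGroup.mk_surjective x
    obtain ⟨h, rfl⟩ := QuotientGroup.mk_surjective y
    rw [QuotientGroup.eq]
    rcases hxy g h rfl rfl with h1 | h1
    · exact h1
    rcases hyx h g rfl rfl with h2 | h2
    · simpa using C.inv_mem h2
    · exact absurd h2 (by simpa using hP.inv_notMem h1)
  le_total x y := by
    by_cases hxy : x = y
    · subst hxy
      exact Or.inl fun g h hg hh => Or.inl (QuotientGroup.eq.1 (hg.trans hh.symm))
    by_contra! hcon
    obtain ⟨⟨g, h, rfl, rfl, h1, h2⟩, ⟨h', g', hh, hg, h3, h4⟩⟩ := hcon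
    have e1 : g⁻¹ * g' ∈ C := QuotientGroup.eq.1 hg.symm
    have e2 : h'⁻¹ * h ∈ C := QuotientGroup.eq.1 hh
    have h5 : (g⁻¹ * h)⁻¹ ∈ P := hP.inv_mem_of_notMem (fun h => h1 (h ▸ C.one_mem)) h2
    have h6 : h⁻¹ * g ∈ P := by simpa using h5
    have h7 : h⁻¹ * g ∉ C := fun h => h1 (by simpa using C.inv_mem h)
    apply h4
    have h8 := hC.mul_mem_left hP h6 h7 e2
    have h9 : h'⁻¹ * h * (h⁻¹ * g) ∉ C := by rwa [C.mul_mem_cancel_left e2]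
    have h10 := hC.mul_mem_right hP h8 h9 e1
    convert h10 using 1
    group
  toDecidableLE := Classical.decRel _

theorem coset_lt_iff (hC : IsConvexFor P C) (hP : IsPositiveCone P) (g h : G) :
    (hC.cosetLinearOrder hP).lt (g : G ⧸ C) h ↔ g⁻¹ * h ∈ P ∧ g⁻¹ * h ∉ C := by
  let _ := hC.cosetLinearOrder hP
  change (g : G ⧸ C) < h ↔ _
  have hinv : ∀ x y : G, x⁻¹ * y ∈ C ↔ y⁻¹ * x ∈ C := fun x y => by
    rw [← C.inv_mem_iff]
    simp
  constructor
  · intro hlt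
    have h1 : g⁻¹ * h ∉ C := fun h => hlt.ne (QuotientGroup.eq.2 h)
    exact ⟨(hlt.le g h rfl rfl).resolve_left h1, h1⟩
  · rintro ⟨h1, h2⟩
    rw [← not_le]
    intro hle
    rcases hle h g rfl rfl with h3 | h3
    · exact h2 ((hinv _ _).1 h3)
    · exact hP.inv_notMem h1 (by simpa using h3)

theorem isOrderedAction (hC : IsConvexFor P C) (hP : IsPositiveCone P) :
    @IsOrderedAction G (G ⧸ C) _ (hC.cosetLinearOrder hP) _ := by
  let _ := hC.cosetLinearOrder hP
  intro g α β h
  obtain ⟨a, rfl⟩ := QuotientGroup.mk_surjective α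
  obtain ⟨b, rfl⟩ := QuotientGroup.mk_surjective β
  have h' := (hC.coset_lt_iff hP a b).1 h
  have := (hC.coset_lt_iff hP (g * a) (g * b)).2 (by simpa [mul_assoc] using h')
  exact this

/-- A convex subgroup that contains every proper convex subgroup makes the coset space primitive. -/
theorem isOrderPrimitiveAt (hC : IsConvexFor P C) (hP : IsPositiveCone P)
    (hmax : ∀ D : Subgroup G, IsConvexFor P D → D ≠ ⊤ → D ≤ C) (ω : G ⧸ C) :
    @IsOrderPrimitiveAt G (G ⧸ C) _ (hC.cosetLinearOrder hP) _ ω := by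
  let _ := hC.cosetLinearOrder hP
  intro D hD ⟨g, hgD, hg⟩
  obtain ⟨k, rfl⟩ := QuotientGroup.mk_surjective ω
  have hconv : IsConvexFor P (D.comap (MulAut.conj k).toMonoidHom) := by
    intro x hx y hy hxy
    change k * (x * y) * k⁻¹ ∈ D at hxy
    change k * x * k⁻¹ ∈ D
    have hle : ∀ a b : G, a⁻¹ * b ∈ P → (a : G ⧸ C) ≤ b := by
      intro a b hab
      by_cases hmem : a⁻¹ * b ∈ C
      · exact (QuotientGroup.eq.2 hmem : (a : G ⧸ C) = b).le
      · exact le_of_lt ((hC.coset_lt_iff hP a b).2 ⟨hab, hmem⟩)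
    refine hD _ _ hxy ?_ ?_
    · refine hle k (k * x * k⁻¹ * k) ?_
      simpa [mul_assoc] using hx
    · refine hle (k * x * k⁻¹ * k) (k * (x * y) * k⁻¹ * k) ?_
      simpa [mul_assoc] using hy
  by_contra hne
  have hle := hmax _ hconv (fun htop => hne (by
    rw [eq_top_iff]
    intro d _
    have : k⁻¹ * d * k ∈ D.comap (MulAut.conj k).toMonoidHom := htop ▸ Subgroup.mem_top _
    have h2 : k * (k⁻¹ * d * k) * k⁻¹ ∈ D := this
    simpa [mul_assoc] using h2))
  have hmem : k⁻¹ * g * k ∈ D.comap (MulAut.conj k).toMonoidHom := by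
    change k * (k⁻¹ * g * k) * k⁻¹ ∈ D
    simpa [mul_assoc] using hgD
  apply hg
  have : (k : G ⧸ C) = (g * k : G) := QuotientGroup.eq.2 (by simpa [mul_assoc] using hle hmem)
  exact this.symm

open MulAction Topology in
/-- If in every right neighbourhood of the base point of `G ⧸ C` there is a point that is moved
down by an element that moves the base point up, then some cone is condensed. -/
theorem exists_isCondensed (hC : IsConvexFor P C) (hP : IsPositiveCone P) (hne : C ≠ ⊤)
    (h : ∀ s ∈ P, s ∉ C → ∃ g t : G, (g ∈ C ∨ g ∈ P) ∧ g⁻¹ * s ∈ P ∧ g⁻¹ * s ∉ C ∧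
      t ∈ P ∧ t ∉ C ∧ (g⁻¹ * t * g)⁻¹ ∈ P ∧ g⁻¹ * t * g ∉ C) :
    ∃ Q : Set G, IsPositiveCone Q ∧ IsCondensed Q := by
  classical
  obtain ⟨s₀, hs₀P, hs₀C⟩ : ∃ s ∈ P, s ∉ C := by
    by_contra! hcon
    refine hne (eq_top_iff.2 fun x _ => ?_)
    rcases hP.trichotomy x with hx | rfl | hx
    · exact hcon x hx
    · exact C.one_mem
    · simpa using hcon _ hx
  -- `F` consists of the cones that agree with `P` off `C`, with an arbitrary order on `C`.
  let F : Set (LO G) := ⋂ S : {S : Finset G // ↑S ⊆ P \ C}, {Q : LO G | ↑S.1 ⊆ Q.1}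
  have hmemF : ∀ Q : LO G, Q ∈ F ↔ P \ C ⊆ Q.1 := by
    intro Q
    simp only [F, Set.mem_iInter]
    constructor
    · intro hQ x hx
      simpa using hQ ⟨{x}, by simpa using hx⟩
    · exact fun hQ S => S.2.trans hQ
  have hclosed : IsClosed F := isClosed_iInter fun S => (LO.isClopen_setOf_subset S.1).1
  have hacc : ∀ Q ∈ F, (derivedSet (orbit G Q) ∩ F).Nonempty := by
    intro Q hQ
    by_contra hcon
    have hU : ∀ Z ∈ F, ∃ U : Set (LO G), IsOpen U ∧ Z ∈ U ∧ ∀ y ∈ U, y ∈ orbit G Q → y = Z := by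
      intro Z hZ
      have : Z ∉ derivedSet (orbit G Q) := fun hmem => hcon ⟨Z, hmem, hZ⟩
      rw [mem_derivedSet, accPt_iff_nhds] at this
      push Not at this
      obtain ⟨U, hU, hUZ⟩ := this
      obtain ⟨V, hVU, hV, hZV⟩ := mem_nhds_iff.1 hU
      exact ⟨V, hV, hZV, fun y hy hyQ => hUZ y ⟨hVU hy, hyQ⟩⟩
    have hne : Nonempty {S : Finset G // ↑S ⊆ P \ C} := ⟨⟨∅, by simp⟩⟩
    -- If the orbit of `Q` had no accumulation point in `F`, compactness would give a finite `S ⊆ P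
    -- \ C` such that every conjugate of `Q` containing `S` already lies in `F`.
    obtain ⟨S, hS⟩ := exists_subset_nhds_of_isCompact
      (V := fun S : {S : Finset G // ↑S ⊆ P \ C} => {Q : LO G | ↑S.1 ⊆ Q.1})
      (U := {y | y ∈ orbit G Q → y ∈ F})
      (fun S T => ⟨⟨S.1 ∪ T.1, by
          rw [Finset.coe_union]
          exact Set.union_subset S.2 T.2⟩,
        fun Q hQ => by
          have : (↑(S.1 ∪ T.1) : Set G) ⊆ Q.1 := hQ
          rw [Finset.coe_union, Set.union_subset_iff] at this
          exact this.1,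
        fun Q hQ => by
          have : (↑(S.1 ∪ T.1) : Set G) ⊆ Q.1 := hQ
          rw [Finset.coe_union, Set.union_subset_iff] at this
          exact this.2⟩)
      (fun S => (LO.isClopen_setOf_subset S.1).1.isCompact)
      (fun Z hZ => by
        obtain ⟨U, hU, hZU, hUZ⟩ := hU Z hZ
        refine Filter.mem_of_superset (hU.mem_nhds hZU) fun y hy hyQ => ?_
        rw [hUZ y hy hyQ]
        exact hZ)
    have hmin : ∀ T : Finset G, T.Nonempty → ∃ s ∈ T, ∀ x ∈ T, s⁻¹ * x = 1 ∨ s⁻¹ * x ∈ P := by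
      intro T hT
      induction hT using Finset.Nonempty.cons_induction with
      | singleton a => exact ⟨a, by simp, by simp⟩
      | cons a T ha hT ih =>
        obtain ⟨s, hs, hsT⟩ := ih
        rcases hP.trichotomy (s⁻¹ * a) with h1 | h1 | h1
        · refine ⟨s, by simp [hs], fun x hx => ?_⟩
          rcases Finset.mem_cons.1 hx with rfl | hx
          · exact Or.inr h1
          · exact hsT x hx
        · refine ⟨s, by simp [hs], fun x hx => ?_⟩
          rcases Finset.mem_cons.1 hx with rfl | hx
          · exact Or.inl h1
          · exact hsT x hx
        · refine ⟨a, by simp, fun x hx => ?_⟩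
          rcases Finset.mem_cons.1 hx with rfl | hx
          · exact Or.inl (by simp)
          · have h2 : a⁻¹ * s ∈ P := by simpa using h1
            rcases hsT x hx with h3 | h3
            · rw [inv_mul_eq_one] at h3
              exact Or.inr (h3 ▸ h2)
            · exact Or.inr (by simpa [mul_assoc] using hP.mul_mem h2 h3)
    -- Inserting `s₀` ensures that a least element exists even when `S` is empty.
    obtain ⟨s, hsS, hsmin⟩ := hmin (insert s₀ S.1) (Finset.insert_nonempty _ _)
    have hsPC : s ∈ P \ C := by
      rcases Finset.mem_insert.1 hsS with rfl | hs
      · exact ⟨hs₀P, hs₀C⟩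
      · exact S.2 hs
    obtain ⟨g, t, hg, hgs, hgsC, ht, htC, hgt, hgtC⟩ := h s hsPC.1 hsPC.2
    have hmem : (g • Q : LO G) ∈ F := by
      refine hS ?_ ⟨g, rfl⟩
      intro x hx
      rw [LO.mem_smul]
      apply (hmemF Q).1 hQ
      have h1 : g⁻¹ * x ∈ P ∧ g⁻¹ * x ∉ C := by
        have e : g⁻¹ * x = g⁻¹ * s * (s⁻¹ * x) := by group
        rcases hsmin x (Finset.mem_insert_of_mem hx) with h2 | h2
        · rw [e, h2, mul_one]
          exact ⟨hgs, hgsC⟩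
        · rw [e]
          exact ⟨hP.mul_mem hgs h2, hC.notMem_mul hgs hgsC h2⟩
      rcases hg with hg | hg
      · exact ⟨hC.mul_mem_right hP h1.1 h1.2 hg, by
          rw [SetLike.mem_coe, C.mul_mem_cancel_right hg]
          exact h1.2⟩
      · exact ⟨hP.mul_mem h1.1 hg, hC.notMem_mul h1.1 h1.2 hg⟩
    -- `g • Q` contains `S`, so it lies in `F` and contains `t`; but `Q` makes `g⁻¹ * t * g`
    -- negative.
    have h1 := (LO.mem_smul g Q t).1 ((hmemF _).1 hmem ⟨ht, htC⟩)
    have h2 := (hmemF Q).1 hQ ⟨hgt, fun hmem => hgtC (C.inv_mem_iff.1 hmem)⟩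
    exact Q.2.inv_notMem h1 h2
  obtain ⟨Q, hQ⟩ := exists_mem_derivedSet_orbit (G := G) hclosed
    ⟨⟨P, hP⟩, (hmemF _).2 Set.sdiff_subset⟩ hacc
  exact ⟨Q.1, Q.2, (LO.mem_derivedSet_orbit_iff Q).1 hQ⟩

/-- The alternative for the largest proper convex subgroup `C`: either there is a condensed cone,
or `C` is normal with bi-ordered Archimedean quotient. -/
theorem exists_isCondensed_or (hC : IsConvexFor P C) (hP : IsPositiveCone P) (hne : C ≠ ⊤)
    (hmax : ∀ D : Subgroup G, IsConvexFor P D → D ≠ ⊤ → D ≤ C) :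
    (∃ Q : Set G, IsPositiveCone Q ∧ IsCondensed Q) ∨
      (C.Normal ∧ (∀ p ∈ P, p ∉ C → ∀ g : G, g * p * g⁻¹ ∈ P) ∧
        ∀ p ∈ P, p ∉ C → ∀ g : G, ∃ n : ℕ, g⁻¹ * p ^ n ∈ P) := by
  by_cases h : ∀ s ∈ P, s ∉ C → ∃ g t : G, (g ∈ C ∨ g ∈ P) ∧ g⁻¹ * s ∈ P ∧ g⁻¹ * s ∉ C ∧
      t ∈ P ∧ t ∉ C ∧ (g⁻¹ * t * g)⁻¹ ∈ P ∧ g⁻¹ * t * g ∉ C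
  · exact Or.inl (hC.exists_isCondensed hP hne h)
  right
  push Not at h
  obtain ⟨s, hsP, hsC, hs⟩ := h
  let _ := hC.cosetLinearOrder hP
  have hlt : ∀ g h : G, (g : G ⧸ C) < h ↔ g⁻¹ * h ∈ P ∧ g⁻¹ * h ∉ C := hC.coset_lt_iff hP
  have hG : IsOrderedAction G (G ⧸ C) := hC.isOrderedAction hP
  have hprim : ∀ ω : G ⧸ C, IsOrderPrimitiveAt G ω := hC.isOrderPrimitiveAt hP hmax
  have hpos : ∀ p : G, ((1 : G) : G ⧸ C) < p • ((1 : G) : G ⧸ C) ↔ p ∈ P ∧ p ∉ C := by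
    intro p
    have := hlt 1 (p * 1)
    simpa using this
  -- The failed condition says that, near the base point on the right, no point is lowered by an
  -- element raising the base point; primitivity spreads this to all cosets.
  have key : ∀ (t : G) (α β : G ⧸ C), α < t • α → β < t • β := by
    intro t α β
    refine hG.lt_smul_of_forall_le_smul (ω₀ := ((1 : G) : G ⧸ C)) (s := s) hprim
      ((hpos s).2 ⟨hsP, hsC⟩) ?_
    intro ω h1 h2 t ht
    obtain ⟨g, rfl⟩ := QuotientGroup.mk_surjective ω
    by_contra! hcon
    have hg : g ∈ C ∨ g ∈ P := by simpa using h1 1 g rfl rfl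
    have h3 := (hlt g (s * 1)).1 h2
    rw [mul_one] at h3
    have h4 := (hpos t).1 ht
    have h5 := (hlt (t * g) g).1 hcon
    refine h5.2 ?_
    have h6 := hs g t hg h3.1 h3.2 h4.1 h4.2 (by simpa [mul_assoc] using h5.1)
    simpa [mul_assoc] using C.inv_mem h6
  have hconj : ∀ p ∈ P, p ∉ C → ∀ g : G, g * p * g⁻¹ ∈ P ∧ g * p * g⁻¹ ∉ C := by
    intro p hp hpC g
    have h1 := key p _ (g⁻¹ : G) ((hpos p).2 ⟨hp, hpC⟩)
    have h2 := (hlt g⁻¹ (p * g⁻¹)).1 h1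
    simpa [mul_assoc] using h2
  refine ⟨⟨fun c hc g => ?_⟩, fun p hp hpC g => (hconj p hp hpC g).1, fun p hp hpC g => ?_⟩
  · by_contra hcon
    rcases hP.trichotomy (g * c * g⁻¹) with h1 | h1 | h1
    · exact (hconj _ h1 hcon g⁻¹).2 (by simpa [mul_assoc] using hc)
    · exact hcon (h1 ▸ C.one_mem)
    · exact (hconj _ h1 (fun hmem => hcon (C.inv_mem_iff.1 hmem)) g⁻¹).2 (by simpa [mul_assoc] using hc)
  · have hX : IsMonotoneOn G (Set.range fun n : ℤ => p ^ n • ((1 : G) : G ⧸ C)) :=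
      fun α _ β _ t ht => (key t α β ht).le
    obtain ⟨n, -, hn⟩ := hG.exists_zpow_bounds (hprim _) ((hpos p).2 ⟨hp, hpC⟩) hX g
    have := ((hlt (g * 1) (p ^ (n : ℤ) * 1)).1 hn).1
    exact ⟨n, by simpa using this⟩

end IsConvexFor

/-! ### Hölder's theorem: Archimedean bi-ordered groups are commutative -/

section Hoelder

variable {X : Type*} [Group X] [LinearOrder X]

theorem exists_pow_le_lt_pow_succ (harch : ∀ p g : X, 1 < p → ∃ n : ℕ, g < p ^ n) {d a : X}
    (hd : 1 < d) (ha : 1 ≤ a) : ∃ m : ℕ, d ^ m ≤ a ∧ a < d ^ (m + 1) := by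
  classical
  have h := harch d a hd
  have hpos : Nat.find h ≠ 0 := by
    intro h0
    have := Nat.find_spec h
    rw [h0, pow_zero] at this
    exact this.not_ge ha
  obtain ⟨m, hm⟩ := Nat.exists_eq_succ_of_ne_zero hpos
  refine ⟨m, ?_, ?_⟩
  · exact not_lt.1 (Nat.find_min h (by omega))
  · have := Nat.find_spec h
    rwa [hm] at this

/-- An Archimedean bi-ordered group is commutative. -/
theorem mul_comm_of_archimedean [MulLeftStrictMono X] [MulRightStrictMono X]
    (harch : ∀ p g : X, 1 < p → ∃ n : ℕ, g < p ^ n) (a b : X) : a * b = b * a := by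
  have := mulLeftMono_of_mulLeftStrictMono X
  have := mulRightMono_of_mulRightStrictMono X
  have key : ∀ a b : X, 1 < a → 1 < b → ¬ b * a < a * b := by
    intro a b ha hb hlt
    have hc : 1 < a * b * (b * a)⁻¹ := by
      rwa [← div_eq_mul_inv, one_lt_div']
    set c := a * b * (b * a)⁻¹ with hcdef
    have habc : a * b = c * (b * a) := by rw [hcdef, inv_mul_cancel_right]
    clear_value c
    -- If `d * d ≤ c`, squeezing `a` and `b` between consecutive powers of `d` leaves an error in `a
    -- * b` smaller than `d * d`, too small for the commutator `c`. Otherwise `c` is the least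
    -- element above `1` and its powers exhaust the positive elements.
    by_cases hmin : ∃ d : X, 1 < d ∧ d * d ≤ c
    · obtain ⟨d, hd, hdc⟩ := hmin
      obtain ⟨m, hm1, hm2⟩ := exists_pow_le_lt_pow_succ harch hd ha.le
      obtain ⟨n, hn1, hn2⟩ := exists_pow_le_lt_pow_succ harch hd hb.le
      have h1 : a * b < d ^ (m + 1) * d ^ (n + 1) := mul_lt_mul_of_lt_of_lt hm2 hn2
      have h2 : d * d * (d ^ n * d ^ m) ≤ c * (b * a) := mul_le_mul' hdc (mul_le_mul' hn1 hm1)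
      have h3 : d ^ (m + 1) * d ^ (n + 1) = d * d * (d ^ n * d ^ m) := by
        rw [← pow_two, ← pow_add, ← pow_add, ← pow_add]
        congr 1
        omega
      rw [habc, h3] at h1
      exact h1.not_ge h2
    · push Not at hmin
      have hleast : ∀ e : X, 1 < e → c ≤ e := by
        intro e he
        by_contra! hec
        have h1 : 1 < e⁻¹ * c := by rwa [lt_inv_mul_iff_mul_lt, mul_one]
        rcases le_total e (e⁻¹ * c) with h | h
        · refine (hmin e he).not_ge ?_
          calc e * e ≤ e * (e⁻¹ * c) := mul_le_mul_right h e
            _ = c := by simp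
        · refine (hmin _ h1).not_ge ?_
          calc e⁻¹ * c * (e⁻¹ * c) ≤ e * (e⁻¹ * c) := mul_le_mul_left h _
            _ = c := by simp
      have hpow : ∀ x : X, 1 < x → ∃ m : ℕ, x = c ^ m := by
        intro x hx
        obtain ⟨m, hm1, hm2⟩ := exists_pow_le_lt_pow_succ harch hc hx.le
        refine ⟨m, ?_⟩
        by_contra hne
        have h1 : 1 < (c ^ m)⁻¹ * x := by
          rw [lt_inv_mul_iff_mul_lt, mul_one]
          exact lt_of_le_of_ne hm1 (Ne.symm hne)
        have h2 := hleast _ h1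
        rw [le_inv_mul_iff_mul_le, ← pow_succ] at h2
        exact hm2.not_ge h2
      obtain ⟨m, rfl⟩ := hpow a ha
      obtain ⟨n, rfl⟩ := hpow b hb
      rw [← pow_add, ← pow_add, add_comm] at hlt
      exact lt_irrefl _ hlt
  have key2 : ∀ a b : X, 1 < a → 1 < b → Commute a b := fun a b ha hb =>
    le_antisymm (not_lt.1 (key a b ha hb)) (not_lt.1 (key b a hb ha))
  have key3 : ∀ a b : X, 1 < a → Commute a b := by
    intro a b ha
    rcases lt_trichotomy b 1 with hb | rfl | hb
    · have := key2 a b⁻¹ ha (by simpa using hb)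
      simpa using this.inv_right
    · exact Commute.one_right a
    · exact key2 a b ha hb
  rcases lt_trichotomy a 1 with ha | rfl | ha
  · have := key3 a⁻¹ b (by simpa using ha)
    exact (by simpa using this.inv_left : Commute a b)
  · simp
  · exact key3 a b ha

end Hoelder

/-! ### The linear order of a cone -/

namespace IsPositiveCone

variable {G : Type*} [Group G] {P : Set G}

open Classical in
/-- The left-invariant order with a given positive cone. -/
@[reducible] noncomputable def linearOrder (hP : IsPositiveCone P) : LinearOrder G where
  le x y := x = y ∨ x⁻¹ * y ∈ P
  le_refl x := Or.inl rfl
  le_trans x y z := by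
    rintro (rfl | h1) (rfl | h2)
    · exact Or.inl rfl
    · exact Or.inr h2
    · exact Or.inr h1
    · exact Or.inr (by simpa [mul_assoc] using hP.mul_mem h1 h2)
  le_antisymm x y := by
    rintro (h1 | h1) (h2 | h2)
    · exact h1
    · exact h1
    · exact h2.symm
    · exact absurd h2 (by simpa using hP.inv_notMem h1)
  le_total x y := by
    rcases hP.trichotomy (x⁻¹ * y) with h | h | h
    · exact Or.inl (Or.inr h)
    · exact Or.inl (Or.inl (inv_mul_eq_one.1 h))
    · exact Or.inr (Or.inr (by simpa using h))
  toDecidableLE := Classical.decRel _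

theorem lt_iff (hP : IsPositiveCone P) (x y : G) : hP.linearOrder.lt x y ↔ x⁻¹ * y ∈ P := by
  let _ := hP.linearOrder
  change x < y ↔ _
  constructor
  · intro h
    exact h.le.resolve_left h.ne
  · intro h
    refine lt_of_le_of_ne (Or.inr h) ?_
    rintro rfl
    exact hP.ne_one h (by simp)

theorem mul_comm_of_archimedean (hP : IsPositiveCone P) (hconj : ∀ p ∈ P, ∀ g : G, g * p * g⁻¹ ∈ P)
    (harch : ∀ p ∈ P, ∀ g : G, ∃ n : ℕ, g⁻¹ * p ^ n ∈ P) (a b : G) : a * b = b * a := by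
  let _ := hP.linearOrder
  have hlt : ∀ x y : G, x < y ↔ x⁻¹ * y ∈ P := hP.lt_iff
  have : MulLeftStrictMono G := ⟨fun g x y h => by
    rw [hlt] at h ⊢
    simpa [mul_assoc] using h⟩
  have : MulRightStrictMono G := ⟨fun g x y h => by
    rw [hlt] at h ⊢
    simpa [mul_assoc] using hconj _ h g⁻¹⟩
  refine _root_.mul_comm_of_archimedean (fun p g hp => ?_) a b
  obtain ⟨n, hn⟩ := harch p (by simpa using (hlt 1 p).1 hp) g
  exact ⟨n, (hlt _ _).2 hn⟩

end IsPositiveCone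

/-! ### Isolated cones in commutative groups -/

section CommGroup

variable {X : Type*} [CommGroup X] {P : Set X}

open Submonoid

/-- In a torsion-free commutative group every pointed submonoid is contained in the nonnegative
part of some positive cone. -/
theorem exists_isPositiveCone_of_pointed (htf : ∀ (x : X) (n : ℕ), n ≠ 0 → x ^ n = 1 → x = 1)
    (M : Submonoid X) (hM : ∀ x ∈ M, x⁻¹ ∈ M → x = 1) :
    ∃ Q : Set X, IsPositiveCone Q ∧ ∀ x ∈ M, x ≠ 1 → x ∈ Q := by
  obtain ⟨N, hMN, hN⟩ := zorn_le_nonempty₀ {N : Submonoid X | ∀ x ∈ N, x⁻¹ ∈ N → x = 1} (by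
    intro c hc hchain N₀ hN₀
    have hdir : DirectedOn (· ≤ ·) c := hchain.directedOn
    refine ⟨sSup c, ?_, fun N hN => le_sSup hN⟩
    intro x hx hx'
    rw [Submonoid.mem_sSup_of_directedOn ⟨N₀, hN₀⟩ hdir] at hx hx'
    obtain ⟨A, hA, hxA⟩ := hx
    obtain ⟨B, hB, hxB⟩ := hx'
    obtain ⟨D, hD, hAD, hBD⟩ := hdir A hA B hB
    exact hc hD x (hAD hxA) (hBD hxB)) M hM
  have hNp : ∀ x ∈ N, x⁻¹ ∈ N → x = 1 := hN.prop
  -- By maximality, adjoining `x` destroys pointedness, and the resulting relation puts the inverse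
  -- of a power of `x` in `N`.
  have hpow : ∀ x : X, x ∉ N → ∃ n : ℕ, n ≠ 0 ∧ (x ^ n)⁻¹ ∈ N := by
    intro x hx
    have hnot : ¬ ∀ y ∈ N ⊔ Submonoid.powers x, y⁻¹ ∈ N ⊔ Submonoid.powers x → y = 1 := by
      intro hcon
      exact hx ((hN.2 hcon le_sup_left : N ⊔ Submonoid.powers x ≤ N)
        (le_sup_right (a := N) (Submonoid.mem_powers x)))
    push Not at hnot
    obtain ⟨y, hy, hy', hy1⟩ := hnot
    obtain ⟨a, ha, _, ⟨k, rfl⟩, hak⟩ := Submonoid.mem_sup.1 hy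
    obtain ⟨b, hb, _, ⟨l, rfl⟩, hbl⟩ := Submonoid.mem_sup.1 hy'
    simp only at hak hbl
    have hprod : a * b * x ^ (k + l) = 1 := by
      calc a * b * x ^ (k + l) = (a * x ^ k) * (b * x ^ l) := by
            rw [pow_add, mul_mul_mul_comm]
        _ = 1 := by rw [hak, hbl, mul_inv_cancel]
    refine ⟨k + l, ?_, ?_⟩
    · intro h0
      obtain ⟨rfl, rfl⟩ : k = 0 ∧ l = 0 := by omega
      simp only [pow_zero, mul_one] at hak hbl
      subst hak
      exact hy1 (hNp a ha (hbl ▸ hb))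
    · rw [← eq_inv_of_mul_eq_one_left hprod]
      exact N.mul_mem ha hb
  have htot : ∀ x : X, x ∈ N ∨ x⁻¹ ∈ N := by
    intro x
    by_contra! hcon
    obtain ⟨n, hn, h1⟩ := hpow x hcon.1
    obtain ⟨m, hm, h2⟩ := hpow x⁻¹ hcon.2
    have h3 : x ^ (n * m) ∈ N := by
      have := N.pow_mem h2 n
      rw [← inv_pow, inv_inv, ← pow_mul] at this
      rwa [mul_comm]
    have h4 : (x ^ (n * m))⁻¹ ∈ N := by
      have := N.pow_mem h1 m
      rwa [inv_pow, ← pow_mul] at this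
    have h5 := htf x (n * m) (Nat.mul_ne_zero hn hm) (hNp _ h3 h4)
    exact hcon.1 (h5 ▸ N.one_mem)
  refine ⟨{x | x ∈ N ∧ x ≠ 1}, IsPositiveCone.of_forall ?_ (fun h => h.2 rfl) ?_,
    fun x hx hx1 => ⟨hMN hx, hx1⟩⟩
  · rintro x ⟨hx, hx1⟩ y ⟨hy, hy1⟩
    refine ⟨N.mul_mem hx hy, fun h => hx1 (hNp x hx ?_)⟩
    rwa [← eq_inv_of_mul_eq_one_right h]
  · intro x hx
    exact (htot x).imp (fun h => ⟨h, hx⟩) fun h => ⟨h, inv_ne_one.2 hx⟩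

namespace IsolatedBy

variable {S : Finset X}

theorem mem_or_eq_one_of_mem_closure {T : Set X} (hP : IsPositiveCone P) (hT : T ⊆ P) {x : X}
    (hx : x ∈ closure T) : x ∈ P ∨ x = 1 := by
  induction hx using Submonoid.closure_induction with
  | mem x hx => exact Or.inl (hT hx)
  | one => exact Or.inr rfl
  | mul x y _ _ hx hy =>
    rcases hx with hx | rfl
    · rcases hy with hy | rfl
      · exact Or.inl (hP.mul_mem hx hy)
      · exact Or.inl (by simpa using hx)
    · simpa using hy

/-- Were no power of `p` generated by `S`, adjoining `p⁻¹` would keep the monoid pointed, and a cone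
extending it would contain `S` but differ from `P`. -/
theorem exists_pow_mem_closure (h : IsolatedBy P S) {p : X} (hp : p ∈ P) :
    ∃ n : ℕ, n ≠ 0 ∧ p ^ n ∈ closure (S : Set X) := by
  by_contra! hcon
  obtain ⟨Q, hQ, hMQ⟩ := exists_isPositiveCone_of_pointed
    (fun x n hn hx => h.cone.pow_eq_one hn hx) (closure (S : Set X) ⊔ powers p⁻¹) (by
      intro y hy hy'
      obtain ⟨a, ha, _, ⟨k, rfl⟩, hak⟩ := Submonoid.mem_sup.1 hy
      obtain ⟨b, hb, _, ⟨l, rfl⟩, hbl⟩ := Submonoid.mem_sup.1 hy'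
      simp only at hak hbl
      have hprod : a * b * p⁻¹ ^ (k + l) = 1 := by
        calc a * b * p⁻¹ ^ (k + l) = (a * p⁻¹ ^ k) * (b * p⁻¹ ^ l) := by
              rw [pow_add, mul_mul_mul_comm]
          _ = 1 := by rw [hak, hbl, mul_inv_cancel]
      rw [inv_pow, mul_inv_eq_one] at hprod
      have h0 : k + l = 0 := by
        by_contra h0
        exact hcon _ h0 (hprod ▸ mul_mem ha hb)
      obtain ⟨rfl, rfl⟩ : k = 0 ∧ l = 0 := by omega
      simp only [pow_zero, mul_one] at hak hbl
      subst hak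
      rcases mem_or_eq_one_of_mem_closure h.cone h.subset ha with h1 | h1
      · rcases mem_or_eq_one_of_mem_closure h.cone h.subset hb with h2 | h2
        · exact absurd (hbl ▸ h2) (h.cone.inv_notMem h1)
        · rw [h2] at hbl
          exact inv_eq_one.1 hbl.symm
      · exact h1)
  have hQP := h.eq_of_subset Q hQ fun x hx =>
    hMQ x (le_sup_left (a := closure (S : Set X)) (subset_closure hx))
      (h.cone.ne_one (h.subset hx))
  refine h.cone.inv_notMem hp (hQP ▸ hMQ p⁻¹ (le_sup_right (a := closure (S : Set X))
    (mem_powers p⁻¹)) ?_)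
  simpa using h.cone.ne_one hp

/-- A commutative group with an isolated cone has rank at most one. -/
theorem exists_zpow_eq_zpow (h : IsolatedBy P S) (a : X) {b : X} (hb : b ≠ 1) :
    ∃ m k : ℤ, m ≠ 0 ∧ a ^ m = b ^ k := by
  classical
  have hP := h.cone
  -- Choose a smallest set `T` of positive elements generating `P` up to powers; the aim is that `T`
  -- has at most one element.
  have hex : ∃ (n : ℕ) (T : Finset X), T.card = n ∧ ↑T ⊆ P ∧
      ∀ p ∈ P, ∃ n : ℕ, n ≠ 0 ∧ p ^ n ∈ closure (T : Set X) :=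
    ⟨_, S, rfl, h.subset, fun p hp => h.exists_pow_mem_closure hp⟩
  obtain ⟨T, hTn, hTP, hT⟩ := Nat.find_spec hex
  have hmin : ∀ T' : Finset X, ↑T' ⊆ P →
      (∀ p ∈ P, ∃ n : ℕ, n ≠ 0 ∧ p ^ n ∈ closure (T' : Set X)) → T.card ≤ T'.card :=
    fun T' h1 h2 => hTn ▸ Nat.find_min' hex ⟨T', rfl, h1, h2⟩
  have hcard : T.card ≤ 1 := by
    rw [Finset.card_le_one]
    have key : ∀ s ∈ T, ∀ t ∈ T, s * t⁻¹ ∉ P := by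
      intro s hs t ht hst
      have hne : t ≠ s := by
        rintro rfl
        exact hP.ne_one hst (by simp)
      obtain ⟨n, hn, hc⟩ := hT _ hst
      have hT' : insert s (T.erase s) = T := Finset.insert_erase hs
      have hcl : ∀ x ∈ closure (T : Set X), ∃ (j : ℕ) (d : X),
          d ∈ closure ((T.erase s : Finset X) : Set X) ∧ x = s ^ j * d := by
        intro x hx
        rw [← hT', Finset.coe_insert, Set.insert_eq, Submonoid.closure_union,
          ← Submonoid.powers_eq_closure] at hx
        obtain ⟨_, ⟨j, rfl⟩, d, hd, rfl⟩ := Submonoid.mem_sup.1 hx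
        exact ⟨j, d, hd, rfl⟩
      obtain ⟨j, d, hd, hjd⟩ := hcl _ hc
      -- Writing a power of `s * t⁻¹` through `T` gives this relation. For `j < n` a power of `s` is
      -- generated by the other elements, so `s` is redundant; for `j ≥ n` a product of nonnegative
      -- elements with the positive factor `t ^ n` would equal `1`.
      have hrel : s ^ n = s ^ j * (t ^ n * d) := by
        rw [mul_pow, inv_pow, mul_inv_eq_iff_eq_mul] at hjd
        rw [hjd, mul_assoc, mul_comm d]
      have htd : t ^ n * d ∈ closure ((T.erase s : Finset X) : Set X) :=
        mul_mem (pow_mem (subset_closure (by simp [hne, ht])) n) hd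
      rcases lt_or_ge j n with hjn | hjn
      · have hs' : s ^ (n - j) ∈ closure ((T.erase s : Finset X) : Set X) := by
          have : s ^ (n - j) = t ^ n * d := by
            rw [← mul_right_inj (s ^ j), ← hrel, ← pow_add]
            congr 1
            omega
          rwa [this]
        refine (Finset.card_erase_lt_of_mem hs).not_ge (hmin _ ?_ ?_)
        · exact fun x hx => hTP (Finset.mem_of_mem_erase hx)
        · intro p hp
          obtain ⟨N, hN, hpN⟩ := hT p hp
          obtain ⟨i, e, he, hie⟩ := hcl _ hpN
          refine ⟨N * (n - j), Nat.mul_ne_zero hN (by omega), ?_⟩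
          rw [pow_mul, hie, mul_pow, ← pow_mul, mul_comm i, pow_mul]
          exact mul_mem (pow_mem hs' i) (pow_mem he _)
      · have h1 : s ^ (j - n) * (t ^ n * d) = 1 := by
          rw [← mul_right_inj (s ^ n), ← mul_assoc, ← pow_add, mul_one, show n + (j - n) = j by omega]
          exact hrel.symm
        have h2 : t ^ n ∈ P := hP.pow_mem (hTP ht) hn
        have h3 : t ^ n * (s ^ (j - n) * d) = 1 := by rw [← h1, mul_left_comm]
        have h4 : s ^ (j - n) * d ∈ closure (T : Set X) :=
          mul_mem (pow_mem (subset_closure hs) _)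
            (closure_mono (Finset.coe_subset.2 (Finset.erase_subset s T)) hd)
        rcases mem_or_eq_one_of_mem_closure hP hTP h4 with h5 | h5
        · exact hP.ne_one (hP.mul_mem h2 h5) h3
        · rw [h5, mul_one] at h3
          exact hP.ne_one h2 h3
    intro s hs t ht
    by_contra hne
    rcases hP.mem_or_inv_mem (x := s * t⁻¹) (fun h => hne (mul_inv_eq_one.1 h)) with h1 | h1
    · exact key s hs t ht h1
    · exact key t ht s hs (by simpa using h1)
  obtain ⟨s, hs⟩ : ∃ s : X, ∀ x : X, ∃ m k : ℤ, m ≠ 0 ∧ x ^ m = s ^ k := by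
    obtain ⟨s, hs⟩ := (Finset.card_le_one_iff_subset_singleton (s := T)).1 hcard
    have hpos : ∀ p ∈ P, ∃ m k : ℤ, m ≠ 0 ∧ p ^ m = s ^ k := by
      intro p hp
      obtain ⟨n, hn, hpn⟩ := hT p hp
      have h1 := closure_mono (Finset.coe_subset.2 hs) hpn
      rw [Finset.coe_singleton, Submonoid.mem_closure_singleton] at h1
      obtain ⟨k, hk⟩ := h1
      exact ⟨n, k, by exact_mod_cast hn, by simpa using hk.symm⟩
    refine ⟨s, fun x => ?_⟩
    rcases hP.trichotomy x with hx | rfl | hx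
    · exact hpos x hx
    · exact ⟨1, 0, one_ne_zero, by simp⟩
    · obtain ⟨m, k, hm, hmk⟩ := hpos _ hx
      exact ⟨-m, k, neg_ne_zero.2 hm, by rw [← hmk, zpow_neg, inv_zpow]⟩
  obtain ⟨m, i, hm, hmi⟩ := hs a
  obtain ⟨n, j, hn, hnj⟩ := hs b
  have hj : j ≠ 0 := by
    rintro rfl
    rw [zpow_zero] at hnj
    apply hb
    refine hP.pow_eq_one (Int.natAbs_ne_zero.2 hn) ?_
    rcases Int.natAbs_eq n with h1 | h1 <;> rw [h1] at hnj
    · simpa using hnj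
    · simpa using hnj
  refine ⟨m * j, n * i, mul_ne_zero hm hj, ?_⟩
  rw [zpow_mul, hmi, zpow_mul, hnj, ← zpow_mul, ← zpow_mul, mul_comm]

end IsolatedBy

end CommGroup

/-! ### Changing the order on, or modulo, a convex subgroup -/

namespace IsConvexFor

variable {G : Type*} [Group G] {P : Set G} {C : Subgroup G}

/-- Replacing the order on a convex subgroup yields a left-order. -/
theorem isPositiveCone_extend (hC : IsConvexFor P C) (hP : IsPositiveCone P) {Q : Set C}
    (hQ : IsPositiveCone Q) : IsPositiveCone (Subtype.val '' Q ∪ P \ C) := by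
  refine IsPositiveCone.of_forall ?_ ?_ ?_
  · rintro x (⟨a, ha, rfl⟩ | ⟨hx, hxC⟩) y (⟨b, hb, rfl⟩ | ⟨hy, hyC⟩)
    · exact Or.inl ⟨a * b, hQ.mul_mem ha hb, rfl⟩
    · exact Or.inr ⟨hC.mul_mem_left hP hy hyC a.2, fun h => hyC ((C.mul_mem_cancel_left a.2).1 h)⟩
    · exact Or.inr ⟨hC.mul_mem_right hP hx hxC b.2, fun h => hxC ((C.mul_mem_cancel_right b.2).1 h)⟩
    · exact Or.inr ⟨hP.mul_mem hx hy, hC.notMem_mul hx hxC hy⟩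
  · rintro (⟨a, ha, h⟩ | ⟨h, -⟩)
    · exact hQ.ne_one ha (Subtype.ext h)
    · exact hP.one_notMem h
  · intro x hx
    by_cases hxC : x ∈ C
    · rcases hQ.mem_or_inv_mem (x := ⟨x, hxC⟩) (fun h => hx (congrArg Subtype.val h)) with h | h
      · exact Or.inl (Or.inl ⟨_, h, rfl⟩)
      · exact Or.inr (Or.inl ⟨_, h, rfl⟩)
    · exact (hP.mem_or_inv_mem hx).imp (fun h => Or.inr ⟨h, hxC⟩)
        fun h => Or.inr ⟨h, fun h' => hxC (C.inv_mem_iff.1 h')⟩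

/-- Conjugation by elements of `C` preserves `P \ C`, so only the part of `T` inside `C` constrains
the conjugator. -/
theorem isCondensed_extend (hC : IsConvexFor P C) (hP : IsPositiveCone P) {Q : Set C}
    (hQ : IsCondensed Q) : IsCondensed (Subtype.val '' Q ∪ P \ C) := by
  classical
  intro T hT
  have hmem : ∀ x : C, (x : G) ∈ Subtype.val '' Q ∪ P \ C → x ∈ Q := by
    rintro x (⟨a, ha, h⟩ | ⟨-, h⟩)
    · rwa [← Subtype.ext h]
    · exact absurd x.2 h
  obtain ⟨g, hg, x, hx, hxg⟩ := hQ (T.subtype (· ∈ C)) (by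
    intro x hx
    exact hmem x (hT (Finset.mem_subtype.1 hx)))
  refine ⟨g, fun y hy => ?_, x, Or.inl ⟨x, hx, rfl⟩, fun h => hxg (hmem _ h)⟩
  by_cases hyC : y ∈ C
  · exact Or.inl ⟨_, hg ⟨y, hyC⟩ (Finset.mem_subtype.2 hy), rfl⟩
  · right
    have hyP : y ∈ P := by
      rcases hT hy with ⟨a, -, rfl⟩ | h
      · exact absurd a.2 hyC
      · exact h.1
    have hg' : (g : G)⁻¹ ∈ C := C.inv_mem g.2
    have h1 := hC.mul_mem_left hP hyP hyC hg'
    have h2 : (g : G)⁻¹ * y ∉ C := fun h => hyC ((C.mul_mem_cancel_left hg').1 h)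
    exact ⟨hC.mul_mem_right hP h1 h2 g.2, fun h => h2 ((C.mul_mem_cancel_right g.2).1 h)⟩

theorem inv (hC : IsConvexFor P C) : IsConvexFor P⁻¹ C := by
  intro x hx y hy hxy
  have h1 : y⁻¹ ∈ C := hC _ hy _ hx (by simpa using C.inv_mem hxy)
  exact (C.mul_mem_cancel_right (C.inv_mem_iff.1 h1)).1 hxy

-- Any other order on `C` containing the elements of `S` in `C` would extend by `P \ C` to a second
-- cone of `G` containing `S`.
open Classical in
theorem isolatedBy (hC : IsConvexFor P C) {S : Finset G} (hS : IsolatedBy P S) :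
    IsolatedBy (C.subtype ⁻¹' P) (S.subtype (· ∈ C)) where
  cone := hS.cone.preimage C.subtype_injective
  subset x hx := hS.subset (Finset.mem_subtype.1 hx)
  eq_of_subset Q hQ hSQ := by
    have := hS.eq_of_subset _ (hC.isPositiveCone_extend hS.cone hQ) (by
      intro x hx
      by_cases hxC : x ∈ C
      · exact Or.inl ⟨⟨x, hxC⟩, hSQ (Finset.mem_subtype.2 hx), rfl⟩
      · exact Or.inr ⟨hS.subset hx, hxC⟩)
    refine hQ.eq_of_subset (hS.cone.preimage C.subtype_injective) fun x hx => ?_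
    change (x : G) ∈ P
    rw [← this]
    exact Or.inl ⟨x, hx, rfl⟩

/-- Reversing the order outside `C` and keeping it on `C` would otherwise give a second cone
containing `S`. -/
theorem not_subset_of_isolatedBy (hC : IsConvexFor P C) {S : Finset G} (hS : IsolatedBy P S)
    (hne : C ≠ ⊤) : ¬ (S : Set G) ⊆ C := by
  intro hSC
  have hcone := hC.inv.isPositiveCone_extend hS.cone.inv (hS.cone.preimage C.subtype_injective)
  have heq := hS.eq_of_subset _ hcone fun x hx => Or.inl ⟨⟨x, hSC hx⟩, hS.subset hx, rfl⟩
  refine hne (eq_top_iff.2 fun x _ => ?_)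
  have key : ∀ x, x⁻¹ ∈ P → x ∈ C := by
    intro x hx
    by_contra hxC
    have : x ∈ P := heq ▸ Or.inr ⟨hx, hxC⟩
    exact hS.cone.inv_notMem this hx
  rcases hS.cone.trichotomy x with h | rfl | h
  · exact C.inv_mem_iff.1 (key x⁻¹ (by simpa using h))
  · exact C.one_mem
  · exact key x h

/-- An isolated order on a nontrivial group has a largest proper convex subgroup. -/
theorem _root_.IsolatedBy.exists_isConvexFor [Nontrivial G] {S : Finset G} (hS : IsolatedBy P S) :
    ∃ H : Subgroup G, IsConvexFor P H ∧ H ≠ ⊤ ∧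
      (∀ D : Subgroup G, IsConvexFor P D → D ≠ ⊤ → D ≤ H) ∧ ∃ s ∈ S, s ∉ H := by
  have hP := hS.cone
  let _ := hP.linearOrder
  have hlt : ∀ x y : G, x < y ↔ x⁻¹ * y ∈ P := hP.lt_iff
  have hSne : S.Nonempty := by
    rw [Finset.nonempty_iff_ne_empty]
    rintro rfl
    exact (IsConvexFor.bot hP).not_subset_of_isolatedBy hS bot_ne_top (by simp)
  -- A proper convex subgroup containing the largest element of `S` would contain `S`. Hence `s`
  -- avoids all of them, and also their union `H`.
  obtain ⟨s, hs, hsmax⟩ := S.exists_max_image id hSne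
  have hsD : ∀ D : Subgroup G, IsConvexFor P D → D ≠ ⊤ → s ∉ D := by
    intro D hD hne hsD
    refine hD.not_subset_of_isolatedBy hS hne fun x hx => ?_
    rcases (hsmax x hx : x ≤ s).eq_or_lt with rfl | h
    · exact hsD
    · exact hD x (hS.subset hx) _ ((hlt x s).1 h) (by simpa using hsD)
  let H : Subgroup G :=
    { carrier := {g | ∃ D : Subgroup G, IsConvexFor P D ∧ D ≠ ⊤ ∧ g ∈ D}
      one_mem' := ⟨⊥, IsConvexFor.bot hP, bot_ne_top, Subgroup.one_mem _⟩
      mul_mem' := by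
        rintro a b ⟨D, hD, hDne, ha⟩ ⟨E, hE, hEne, hb⟩
        rcases hD.le_or_le hE hP with h | h
        · exact ⟨E, hE, hEne, E.mul_mem (h ha) hb⟩
        · exact ⟨D, hD, hDne, D.mul_mem ha (h hb)⟩
      inv_mem' := by
        rintro a ⟨D, hD, hDne, ha⟩
        exact ⟨D, hD, hDne, D.inv_mem ha⟩ }
  have hsH : s ∉ H := by
    rintro ⟨D, hD, hDne, h⟩
    exact hsD D hD hDne h
  refine ⟨H, ?_, fun h => hsH (h ▸ Subgroup.mem_top s), fun D hD hne x hx => ⟨D, hD, hne, hx⟩,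
    s, hs, hsH⟩
  rintro x hx y hy ⟨D, hD, hDne, hxy⟩
  exact ⟨D, hD, hDne, hD x hx y hy hxy⟩

section Quotient

variable {N : Subgroup G}

/-- The positive cone of the quotient by a normal convex subgroup. -/
def quotientCone (P : Set G) (N : Subgroup G) : Set (G ⧸ N) := QuotientGroup.mk '' (P \ N)

theorem mk_mem_quotientCone (hN : IsConvexFor P N) (hP : IsPositiveCone P) (g : G) :
    (g : G ⧸ N) ∈ quotientCone P N ↔ g ∈ P ∧ g ∉ N := by
  constructor
  · rintro ⟨x, ⟨hx, hxN⟩, h⟩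
    have h1 : x⁻¹ * g ∈ N := QuotientGroup.eq.1 h
    have e : g = x * (x⁻¹ * g) := by simp
    rw [e]
    exact ⟨hN.mul_mem_right hP hx hxN h1, fun h => hxN ((N.mul_mem_cancel_right h1).1 h)⟩
  · exact fun h => ⟨g, h, rfl⟩

variable [N.Normal]

theorem isPositiveCone_quotientCone (hN : IsConvexFor P N) (hP : IsPositiveCone P) :
    IsPositiveCone (quotientCone P N) := by
  have hmem := hN.mk_mem_quotientCone hP
  refine IsPositiveCone.of_forall ?_ ?_ ?_
  · intro x hx y hy
    obtain ⟨a, rfl⟩ := QuotientGroup.mk_surjective x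
    obtain ⟨b, rfl⟩ := QuotientGroup.mk_surjective y
    rw [hmem] at hx hy
    rw [← QuotientGroup.mk_mul, hmem]
    exact ⟨hP.mul_mem hx.1 hy.1, hN.notMem_mul hx.1 hx.2 hy.1⟩
  · rw [← QuotientGroup.mk_one, hmem]
    exact fun h => hP.one_notMem h.1
  · intro x hx
    obtain ⟨a, rfl⟩ := QuotientGroup.mk_surjective x
    have ha : a ∉ N := fun h => hx ((QuotientGroup.eq_one_iff a).2 h)
    rw [← QuotientGroup.mk_inv, hmem, hmem]
    rcases hP.mem_or_inv_mem (x := a) (fun h => ha (h ▸ N.one_mem)) with h | h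
    · exact Or.inl ⟨h, ha⟩
    · exact Or.inr ⟨h, fun h' => ha (N.inv_mem_iff.1 h')⟩

/-- The lexicographic order on an extension. -/
theorem _root_.IsPositiveCone.preimage_mk_union (hP : IsPositiveCone P) {Q : Set (G ⧸ N)}
    (hQ : IsPositiveCone Q) : IsPositiveCone (QuotientGroup.mk ⁻¹' Q ∪ P ∩ N : Set G) := by
  refine IsPositiveCone.of_forall ?_ ?_ ?_
  · rintro x (hx | ⟨hx, hxN⟩) y (hy | ⟨hy, hyN⟩)
    · exact Or.inl (hQ.mul_mem hx hy)
    · refine Or.inl ?_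
      have h1 : ((x * y : G) : G ⧸ N) = x := QuotientGroup.mk_mul_of_mem x hyN
      exact (h1.symm ▸ hx : ((x * y : G) : G ⧸ N) ∈ Q)
    · refine Or.inl ?_
      have h1 : ((x * y : G) : G ⧸ N) = y := by
        rw [QuotientGroup.mk_mul, (QuotientGroup.eq_one_iff x).2 hxN, one_mul]
      exact (h1.symm ▸ hy : ((x * y : G) : G ⧸ N) ∈ Q)
    · exact Or.inr ⟨hP.mul_mem hx hy, N.mul_mem hxN hyN⟩
  · rintro (h | h)
    · exact hQ.one_notMem h
    · exact hP.one_notMem h.1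
  · intro x hx
    by_cases hxN : x ∈ N
    · exact (hP.mem_or_inv_mem hx).imp (fun h => Or.inr ⟨h, hxN⟩)
        fun h => Or.inr ⟨h, N.inv_mem hxN⟩
    · exact (hQ.mem_or_inv_mem (x := (x : G ⧸ N))
        fun h => hxN ((QuotientGroup.eq_one_iff x).1 h)).imp Or.inl Or.inl

/-- A different order on the quotient containing the image of `S` would lift lexicographically to a
different order on `G` containing `S`. -/
theorem exists_isolatedBy_quotientCone (hN : IsConvexFor P N) {S : Finset G}
    (hS : IsolatedBy P S) : ∃ T : Finset (G ⧸ N), IsolatedBy (quotientCone P N) T := by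
  classical
  have hmem := hN.mk_mem_quotientCone hS.cone
  have hcone := hN.isPositiveCone_quotientCone hS.cone
  refine ⟨(S.filter (· ∉ N)).image QuotientGroup.mk, hcone, ?_, ?_⟩
  · intro x hx
    obtain ⟨s, hs, rfl⟩ := Finset.mem_image.1 (Finset.mem_coe.1 hx)
    rw [Finset.mem_filter] at hs
    exact (hmem s).2 ⟨hS.subset hs.1, hs.2⟩
  · intro Q hQ hSQ
    have heq := hS.eq_of_subset _ (hS.cone.preimage_mk_union hQ) (by
      intro x hx
      by_cases hxN : x ∈ N
      · exact Or.inr ⟨hS.subset hx, hxN⟩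
      · exact Or.inl (hSQ (Finset.mem_coe.2 (Finset.mem_image_of_mem _
          (Finset.mem_filter.2 ⟨hx, hxN⟩)))))
    refine hQ.eq_of_subset hcone fun x hx => ?_
    obtain ⟨g, rfl⟩ := QuotientGroup.mk_surjective x
    refine (hmem g).2 ⟨heq ▸ Or.inl hx, fun hg => ?_⟩
    exact hQ.ne_one hx ((QuotientGroup.eq_one_iff g).2 hg)

end Quotient

end IsConvexFor

/-! ### Roots, powers and rank one quotients -/

namespace IsPositiveCone

variable {G : Type*} [Group G] {P : Set G}

theorem zpow_eq_one (hP : IsPositiveCone P) {x : G} {n : ℤ} (hn : n ≠ 0) (h : x ^ n = 1) :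
    x = 1 := by
  refine hP.pow_eq_one (Int.natAbs_ne_zero.2 hn) ?_
  rcases Int.natAbs_eq n with h1 | h1 <;> rw [h1] at h
  · simpa using h
  · simpa using h

theorem mem_of_pow_mem (hP : IsPositiveCone P) {x : G} {n : ℕ} (h : x ^ n ∈ P) : x ∈ P := by
  have hn : n ≠ 0 := by
    rintro rfl
    exact hP.one_notMem (by simpa using h)
  rcases hP.trichotomy x with hx | rfl | hx
  · exact hx
  · exact absurd (by simpa using h) hP.one_notMem
  · exact absurd (by simpa using hP.pow_mem hx hn) (hP.inv_notMem h)

theorem exists_pow_eq_pow (hP : IsPositiveCone P) {x y : G} (hx : x ∈ P) (hy : y ∈ P) {m k : ℤ}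
    (hm : m ≠ 0) (h : x ^ m = y ^ k) : ∃ i j : ℕ, i ≠ 0 ∧ j ≠ 0 ∧ x ^ i = y ^ j := by
  have key : ∀ (i : ℕ) (k : ℤ), i ≠ 0 → x ^ i = y ^ k → ∃ i j : ℕ, i ≠ 0 ∧ j ≠ 0 ∧ x ^ i = y ^ j := by
    intro i k hi hik
    have hxi := hP.pow_mem hx hi
    rcases Int.natAbs_eq k with h1 | h1
    · refine ⟨i, k.natAbs, hi, ?_, by rw [hik, ← zpow_natCast, ← h1]⟩
      intro h0
      rw [h1, h0] at hik
      exact hP.ne_one hxi (by simpa using hik)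
    · exfalso
      rcases eq_or_ne k.natAbs 0 with h0 | h0
      · rw [h1, h0] at hik
        exact hP.ne_one hxi (by simpa using hik)
      · rw [h1, zpow_neg, zpow_natCast] at hik
        exact hP.inv_notMem (hP.pow_mem hy h0) (hik ▸ hxi)
  rcases Int.natAbs_eq m with h1 | h1
  · refine key m.natAbs k (Int.natAbs_ne_zero.2 hm) ?_
    rw [← h, ← zpow_natCast, ← h1]
  · refine key m.natAbs (-k) (Int.natAbs_ne_zero.2 hm) ?_
    rw [zpow_neg, ← h, ← zpow_natCast, ← zpow_neg]
    congr 1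
    omega

end IsPositiveCone

theorem IsConvexFor.mem_of_zpow_mem {G : Type*} [Group G] {P : Set G} {C : Subgroup G}
    (hC : IsConvexFor P C) (hP : IsPositiveCone P) {x : G} {n : ℤ} (hn : n ≠ 0) (h : x ^ n ∈ C) :
    x ∈ C := by
  refine hC.mem_of_pow_mem hP (Int.natAbs_ne_zero.2 hn) ?_
  rcases Int.natAbs_eq n with h1 | h1 <;> rw [h1] at h
  · exact (zpow_natCast x _ ▸ h :)
  · rw [zpow_neg, C.inv_mem_iff, zpow_natCast] at h
    exact h

open scoped commutatorElement in
/-- The quotient by the normal subgroup `K` is commutative of rank at most one. -/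
structure IsRankOneMod {G : Type*} [Group G] (K : Subgroup G) : Prop where
  normal : K.Normal
  comm : ∀ a b : G, ⁅a, b⁆ ∈ K
  rank : ∀ a b : G, b ∉ K → ∃ m k : ℤ, m ≠ 0 ∧ a ^ m * (b ^ k)⁻¹ ∈ K

/-! ### Orders from commutators, and non-isolation without inversion -/

section CommutatorCone

open scoped commutatorElement

variable {A : Type*} [Group A] {P : Set A} {B : Subgroup A}

theorem commutator_mul_left (a b t : A) : ⁅a * b, t⁆ = a * ⁅b, t⁆ * a⁻¹ * ⁅a, t⁆ := by
  simp only [commutatorElement_def]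
  group

theorem commutator_inv_left (a t : A) : ⁅a⁻¹, t⁆ = a⁻¹ * ⁅a, t⁆⁻¹ * a := by
  simp only [commutatorElement_def]
  group

/-- The cone of the order obtained by comparing the images of the fixed point of `t`. -/
def commutatorCone (P : Set A) (t : A) : Set A := {a | ⁅a, t⁆ ∈ P ∨ ⁅a, t⁆ = 1 ∧ a ∈ P}

/-- Commutators lie in `B`, where positivity is conjugation invariant, so the cocycle identity
`commutator_mul_left` lets signs multiply; `P` breaks ties on the centralizer of `t`. -/
theorem isPositiveCone_commutatorCone (hP : IsPositiveCone P) (hB : IsRankOneMod B)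
    (hconj : ∀ p ∈ P, p ∈ B → ∀ g : A, g * p * g⁻¹ ∈ P) (t : A) :
    IsPositiveCone (commutatorCone P t) := by
  refine IsPositiveCone.of_forall ?_ ?_ ?_
  · rintro a ha b hb
    change ⁅a * b, t⁆ ∈ P ∨ ⁅a * b, t⁆ = 1 ∧ a * b ∈ P
    rw [commutator_mul_left]
    rcases ha with ha | ⟨ha, ha'⟩ <;> rcases hb with hb | ⟨hb, hb'⟩
    · exact Or.inl (hP.mul_mem (hconj _ hb (hB.comm _ _) a) ha)
    · exact Or.inl (by simpa [hb] using ha)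
    · exact Or.inl (by simpa [ha] using hconj _ hb (hB.comm _ _) a)
    · exact Or.inr ⟨by simp [ha, hb], hP.mul_mem ha' hb'⟩
  · rintro (h | ⟨-, h⟩)
    · exact hP.one_notMem (by simpa using h)
    · exact hP.one_notMem h
  · intro a ha
    change (⁅a, t⁆ ∈ P ∨ ⁅a, t⁆ = 1 ∧ a ∈ P) ∨ (⁅a⁻¹, t⁆ ∈ P ∨ ⁅a⁻¹, t⁆ = 1 ∧ a⁻¹ ∈ P)
    rw [commutator_inv_left]
    rcases hP.trichotomy ⁅a, t⁆ with h | h | h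
    · exact Or.inl (Or.inl h)
    · rcases hP.mem_or_inv_mem ha with h' | h'
      · exact Or.inl (Or.inr ⟨h, h'⟩)
      · exact Or.inr (Or.inr ⟨by simp [h], h'⟩)
    · refine Or.inr (Or.inl ?_)
      simpa using hconj _ h (B.inv_mem (hB.comm _ _)) a⁻¹

/-- An order with two consecutive rank one jumps and no element inverting the smaller one is not
isolated: the commutative case. -/
theorem not_isolatedBy_of_central (hB : IsConvexFor P B) (hBr : IsRankOneMod B) (hbot : B ≠ ⊥)
    (htop : B ≠ ⊤) (hcen : ∀ a : A, ∀ b ∈ B, a * b = b * a) (S : Finset A) :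
    ¬ IsolatedBy P S := by
  intro hS
  have hP := hS.cone
  have hcomm : ∀ x y : A, x * y = y * x := by
    intro x y
    by_cases hy : y ∈ B
    · exact hcen x y hy
    obtain ⟨m, k, hm, hmk⟩ := hBr.rank x y hy
    set b := x ^ m * (y ^ k)⁻¹ with hb
    have hxm : x ^ m = b * y ^ k := by simp [hb]
    -- Since `x ^ m` is a power of `y` times a central element, it commutes with `y`. As `⁅y, x⁆` is
    -- central, its `m`-th power is then trivial, so it is trivial by torsion-freeness.
    have h1 : y * x ^ m * y⁻¹ = x ^ m := by
      rw [hxm, ← mul_assoc, hcen y b hmk, mul_assoc b, mul_assoc b, ← zpow_one_add, add_comm,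
        zpow_add_one, mul_inv_cancel_right]
    have h2 : y * x * y⁻¹ = ⁅y, x⁆ * x := by
      simp [commutatorElement_def]
    rw [← conj_zpow, h2, Commute.mul_zpow (hcen x _ (hBr.comm y x)).symm, mul_eq_right] at h1
    exact (commutatorElement_eq_one_iff_mul_comm.1 (hP.zpow_eq_one hm h1)).symm
  let _ : CommGroup A := { (inferInstance : Group A) with mul_comm := hcomm }
  obtain ⟨b, hbB, hb1⟩ : ∃ b ∈ B, b ≠ 1 := by
    by_contra! hcon
    exact hbot ((Subgroup.eq_bot_iff_forall B).2 hcon)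
  obtain ⟨a, ha⟩ : ∃ a, a ∉ B := by
    by_contra! hcon
    exact htop (eq_top_iff.2 fun x _ => hcon x)
  obtain ⟨m, k, hm, hmk⟩ := IsolatedBy.exists_zpow_eq_zpow hS a hb1
  exact ha (hB.mem_of_zpow_mem hP hm (hmk ▸ B.zpow_mem hbB k))

theorem commutator_pow_left {x t : A} (hx : Commute x (t * x * t⁻¹)) (n : ℕ) :
    ⁅x ^ n, t⁆ = ⁅x, t⁆ ^ n := by
  have h1 : ∀ y : A, ⁅y, t⁆ = y * (t * y * t⁻¹)⁻¹ := fun y => by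
    rw [commutatorElement_def]
    group
  rw [h1, h1, ← conj_pow, ← inv_pow, ← hx.inv_right.mul_pow]

theorem commutator_pow_right_mem (hP : IsPositiveCone P) (hBn : B.Normal)
    (hconj : ∀ p ∈ P, p ∈ B → ∀ g : A, g * p * g⁻¹ ∈ P) {u b : A} (hb : b ∈ B)
    (h : ⁅u, b⁆ ∈ P) {n : ℕ} (hn : n ≠ 0) : ⁅u ^ n, b⁆ ∈ P := by
  have hmem : ∀ g : A, ⁅g, b⁆ ∈ B := fun g => by
    rw [commutatorElement_def]
    exact B.mul_mem (hBn.conj_mem b hb g) (B.inv_mem hb)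
  induction n with
  | zero => exact absurd rfl hn
  | succ n ih =>
    rcases eq_or_ne n 0 with rfl | hn'
    · simpa using h
    · rw [pow_succ', commutator_mul_left]
      exact hP.mul_mem (hconj _ (ih hn') (hmem _) u) h

/-- An order with two consecutive rank one jumps and no element inverting the smaller one is not
isolated. -/
theorem not_isolatedBy_of_conj_mem (hB : IsConvexFor P B) (hBr : IsRankOneMod B) (hbot : B ≠ ⊥)
    (htop : B ≠ ⊤) (hconj : ∀ p ∈ P, p ∈ B → ∀ g : A, g * p * g⁻¹ ∈ P)
    (hBcomm : ∀ x ∈ B, ∀ y ∈ B, x * y = y * x)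
    (hBrank : ∀ x ∈ B, ∀ y ∈ B, y ≠ 1 → ∃ m k : ℤ, m ≠ 0 ∧ x ^ m = y ^ k) (S : Finset A) :
    ¬ IsolatedBy P S := by
  intro hS
  have hP := hS.cone
  have hBn := hBr.normal
  have hcB : ∀ g : A, ∀ x ∈ B, g * x * g⁻¹ ∈ B := fun g x hx => hBn.conj_mem x hx g
  by_cases hcen : ∀ a : A, ∀ b ∈ B, a * b = b * a
  · exact not_isolatedBy_of_central hB hBr hbot htop hcen S hS
  push Not at hcen
  -- an element `e` expanding a positive element `b` of `B`
  obtain ⟨e, b, hbB, hbP, heb⟩ : ∃ e, ∃ b ∈ B, b ∈ P ∧ ⁅e, b⁆ ∈ P := by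
    obtain ⟨a, b₀, hb₀, hab₀⟩ := hcen
    obtain ⟨b, hbB, hbP, hab⟩ : ∃ b ∈ B, b ∈ P ∧ a * b ≠ b * a := by
      rcases hP.trichotomy b₀ with h | rfl | h
      · exact ⟨b₀, hb₀, h, hab₀⟩
      · simp at hab₀
      · refine ⟨b₀⁻¹, B.inv_mem hb₀, h, fun hc => hab₀ ?_⟩
        have : Commute a b₀⁻¹ := hc
        simpa using this.inv_right.eq
    rcases hP.mem_or_inv_mem (x := ⁅a, b⁆)
      (fun h => hab (commutatorElement_eq_one_iff_mul_comm.1 h)) with h | h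
    · exact ⟨a, b, hbB, hbP, h⟩
    · refine ⟨a⁻¹, b, hbB, hbP, ?_⟩
      rw [commutator_inv_left]
      simpa using hconj _ h (B.inv_mem (hBr.comm a b)) a⁻¹
  have heB : e ∉ B := fun h =>
    hP.ne_one heb (commutatorElement_eq_one_iff_mul_comm.2 (hBcomm e h b hbB))
  -- elements in the same direction as `e` modulo `B` expand `b` as well
  have hexp : ∀ (s : A) (i j : ℕ), i ≠ 0 → j ≠ 0 → (s ^ i)⁻¹ * e ^ j ∈ B → ⁅s, b⁆ ∈ P := by
    intro s i j hi hj hij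
    have h1 : ⁅s ^ i, b⁆ = ⁅e ^ j, b⁆ := by
      have h2 : e ^ j = s ^ i * ((s ^ i)⁻¹ * e ^ j) := by group
      have h3 : ⁅(s ^ i)⁻¹ * e ^ j, b⁆ = 1 :=
        commutatorElement_eq_one_iff_mul_comm.2 (hBcomm _ hij b hbB)
      rw [h2, commutator_mul_left, h3]
      simp
    have h2 : ⁅s ^ i, b⁆ ∈ P := h1 ▸ commutator_pow_right_mem hP hBn hconj hbB heb hj
    rcases hP.trichotomy ⁅s, b⁆ with h | h | h
    · exact h
    · exfalso
      have h3 : Commute (s ^ i) b :=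
        Commute.pow_left (commutatorElement_eq_one_iff_mul_comm.1 h : Commute s b) i
      exact hP.ne_one h2 (commutatorElement_eq_one_iff_mul_comm.2 h3)
    · exfalso
      have h3 : ⁅s⁻¹, b⁆ ∈ P := by
        rw [commutator_inv_left]
        simpa using hconj _ h (B.inv_mem (hBr.comm s b)) s⁻¹
      have h4 := commutator_pow_right_mem hP hBn hconj hbB h3 hi
      rw [inv_pow, commutator_inv_left] at h4
      have h5 := hconj _ h4 (by
        simpa using hcB (s ^ i)⁻¹ _ (B.inv_mem (hBr.comm (s ^ i) b))) (s ^ i)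
      refine hP.inv_notMem h2 ?_
      simpa [mul_assoc] using h5
  have hquot := hB.isPositiveCone_quotientCone hP
  have hmk := hB.mk_mem_quotientCone hP
  have hdir : ∀ s e' : A, s ∈ P → s ∉ B → e' ∈ P → e' ∉ B →
      ∃ i j : ℕ, i ≠ 0 ∧ j ≠ 0 ∧ (s ^ i)⁻¹ * e' ^ j ∈ B := by
    intro s e' hs hsB he' heB'
    obtain ⟨m, k, hm, hmk'⟩ := hBr.rank s e' heB'
    obtain ⟨i, j, hi, hj, hij⟩ := hquot.exists_pow_eq_pow ((hmk s).2 ⟨hs, hsB⟩)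
      ((hmk e').2 ⟨he', heB'⟩) hm (k := k) (by
        rw [← QuotientGroup.mk_zpow, ← QuotientGroup.mk_zpow, ← mul_inv_eq_one,
          ← QuotientGroup.mk_inv, ← QuotientGroup.mk_mul, QuotientGroup.eq_one_iff]
        exact hmk')
    rw [← QuotientGroup.mk_pow, ← QuotientGroup.mk_pow, QuotientGroup.eq] at hij
    exact ⟨i, j, hi, hj, hij⟩
  -- All positive elements outside `B` have the same direction modulo `B`: all expand `b` or all
  -- contract it, according to the sign of `e`. Hence `c` is `b` or `b⁻¹`.
  obtain ⟨c, hcB', hc⟩ : ∃ c ∈ B, ∀ s ∈ P, s ∉ B → s⁻¹ * c⁻¹ * s * c ∈ P := by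
    rcases hP.mem_or_inv_mem (x := e) (fun h => heB (h ▸ B.one_mem)) with he | he
    · refine ⟨b, hbB, fun s hs hsB => ?_⟩
      obtain ⟨i, j, hi, hj, hij⟩ := hdir s e hs hsB he heB
      have h1 := hexp s i j hi hj hij
      have h2 := hconj _ h1 (hBr.comm s b) s⁻¹
      rw [commutatorElement_def, hBcomm _ (hcB s b hbB) _ (B.inv_mem hbB)] at h2
      simpa [mul_assoc] using h2
    · refine ⟨b⁻¹, B.inv_mem hbB, fun s hs hsB => ?_⟩
      obtain ⟨i, j, hi, hj, hij⟩ := hdir s e⁻¹ hs hsB he (fun h => heB (B.inv_mem_iff.1 h))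
      have h1 := hexp s⁻¹ i j hi hj (by
        have h3 : ((s ^ i)⁻¹ * e⁻¹ ^ j)⁻¹ ∈ B := B.inv_mem hij
        have h4 : ((s⁻¹ ^ i)⁻¹ * e ^ j) = s ^ i * (e ^ j * s ^ i) * (s ^ i)⁻¹ := by
          simp [mul_assoc]
        rw [h4]
        refine hcB _ _ ?_
        simpa using h3)
      rw [commutatorElement_def, inv_inv] at h1
      simpa using h1
  -- `t` contracts `B`
  set t := e⁻¹ with ht
  have htB : t ∉ B := fun h => heB (B.inv_mem_iff.1 h)
  have hbt : ⁅b, t⁆ ∈ P := by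
    have h1 := hconj _ heb (hBr.comm e b) e⁻¹
    rw [commutatorElement_def] at h1 ⊢
    simpa [ht, mul_assoc] using h1
  have hcommB : ∀ x ∈ B, ∀ (g : A) (n : ℕ), ⁅x ^ n, g⁆ = ⁅x, g⁆ ^ n := fun x hx g n =>
    commutator_pow_left (hBcomm x hx _ (hcB g x hx)) n
  have hcontr : ∀ x ∈ B, x ∈ P → ⁅x, t⁆ ∈ P := by
    intro x hx hxP
    obtain ⟨m, k, hm, hmk'⟩ := hBrank x hx b hbB (hP.ne_one hbP)
    obtain ⟨i, j, hi, hj, hij⟩ := hP.exists_pow_eq_pow hxP hbP hm hmk'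
    refine hP.mem_of_pow_mem (n := i) ?_
    rw [← hcommB x hx, hij, hcommB b hbB]
    exact hP.pow_mem hbt hj
  have harch : ∀ x ∈ B, x ∈ P → ∀ y ∈ B, ∀ᶠ n : ℕ in Filter.atTop, x ^ n * y ∈ P := by
    intro x hx hxP y hy
    obtain ⟨i, k, hi, hik⟩ : ∃ (i : ℕ) (k : ℤ), i ≠ 0 ∧ y ^ i = x ^ k := by
      obtain ⟨m, k, hm, hmk'⟩ := hBrank y hy x hx (hP.ne_one hxP)
      rcases Int.natAbs_eq m with h1 | h1
      · exact ⟨m.natAbs, k, Int.natAbs_ne_zero.2 hm, by rw [← hmk', ← zpow_natCast, ← h1]⟩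
      · refine ⟨m.natAbs, -k, Int.natAbs_ne_zero.2 hm, ?_⟩
        rw [zpow_neg, ← hmk', ← zpow_natCast, ← zpow_neg]
        congr 1
        omega
    filter_upwards [Filter.eventually_gt_atTop k.natAbs] with n hn
    refine hP.mem_of_pow_mem (n := i) ?_
    have hcm : Commute (x ^ n) y := hBcomm _ (B.pow_mem hx n) y hy
    rw [hcm.mul_pow, hik, ← pow_mul, ← zpow_natCast, ← zpow_add]
    have h1 : (n : ℤ) ≤ ((n * i : ℕ) : ℤ) := by
      exact_mod_cast Nat.le_mul_of_pos_right n (Nat.pos_of_ne_zero hi)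
    obtain ⟨l, hl⟩ := Int.eq_ofNat_of_zero_le (show 0 ≤ ((n * i : ℕ) : ℤ) + k - 1 by omega)
    have h2 : ((n * i : ℕ) : ℤ) + k = ((l + 1 : ℕ) : ℤ) := by push_cast at hl ⊢; omega
    rw [h2, zpow_natCast]
    exact hP.pow_mem hxP (Nat.succ_ne_zero l)
  -- Conjugating `t` by `c ^ n` pushes its fixed point far out along `B`. For `s ∉ B` the commutator
  -- becomes a conjugate of `γ ^ n * ⁅s, t⁆` with `γ = s * ⁅β, t⁆ * s⁻¹` positive in `B`, hence
  -- eventually positive.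
  have hev : ∀ s ∈ S, ∀ᶠ n : ℕ in Filter.atTop, s ∈ commutatorCone P (c ^ n * t * (c ^ n)⁻¹) := by
    intro s hs
    have hsP := hS.subset hs
    have hconjc : ∀ n : ℕ, ⁅s, c ^ n * t * (c ^ n)⁻¹⁆ =
        c ^ n * ⁅(c ^ n)⁻¹ * s * c ^ n, t⁆ * (c ^ n)⁻¹ := by
      intro n
      simp only [commutatorElement_def]
      group
    by_cases hsB : s ∈ B
    · refine Filter.Eventually.of_forall fun n => Or.inl ?_
      have h1 : (c ^ n)⁻¹ * s * c ^ n = s := by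
        rw [mul_assoc, hBcomm s hsB _ (B.pow_mem hcB' n), inv_mul_cancel_left]
      rw [hconjc, h1]
      exact hconj _ (hcontr s hsB hsP) (hBr.comm s t) _
    · set β := s⁻¹ * c⁻¹ * s * c with hβ
      have hβP : β ∈ P := hc s hsP hsB
      have hβB : β ∈ B := B.mul_mem (by simpa using hcB s⁻¹ c⁻¹ (B.inv_mem hcB')) hcB'
      have hγ : s * ⁅β, t⁆ * s⁻¹ ∈ P := hconj _ (hcontr β hβB hβP) (hBr.comm β t) s
      filter_upwards [harch _ (hcB s _ (hBr.comm β t)) hγ _ (hBr.comm s t)] with n hn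
      left
      have h1 : (c ^ n)⁻¹ * s * c ^ n = s * β ^ n := by
        have hcm : Commute (s⁻¹ * c⁻¹ * s) c :=
          hBcomm _ (by simpa using hcB s⁻¹ c⁻¹ (B.inv_mem hcB')) c hcB'
        have h2 : (s⁻¹ * c⁻¹ * s) ^ n = s⁻¹ * (c ^ n)⁻¹ * s := by
          have := conj_pow (a := s⁻¹) (b := c⁻¹) (i := n)
          simpa using this
        rw [hβ, hcm.mul_pow, h2]
        group
      rw [hconjc, h1, commutator_mul_left, hcommB β hβB, ← conj_pow]
      refine hconj _ hn (B.mul_mem (B.pow_mem (hcB s _ (hBr.comm β t)) n) (hBr.comm s t)) _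
  obtain ⟨n, hn⟩ := ((Filter.eventually_all_finset S).2 hev).exists
  set τ := c ^ n * t * (c ^ n)⁻¹ with hτ
  have hτB : τ ∉ B := fun h => htB (by simpa [hτ, mul_assoc] using hcB (c ^ n)⁻¹ τ h)
  have heq := hS.eq_of_subset _ (isPositiveCone_commutatorCone hP hBr hconj τ) hn
  have hbτ : ⁅b, τ⁆ ∈ P := by
    have h1 : (c ^ n)⁻¹ * b * c ^ n = b := by
      rw [mul_assoc, hBcomm b hbB _ (B.pow_mem hcB' n), inv_mul_cancel_left]
    have h2 : ⁅b, τ⁆ = c ^ n * ⁅(c ^ n)⁻¹ * b * c ^ n, t⁆ * (c ^ n)⁻¹ := by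
      simp only [hτ, commutatorElement_def]
      group
    rw [h2, h1]
    exact hconj _ hbt (hBr.comm b t) _
  -- Isolation forces `P` to be the commutator cone of `τ`, in which `b` dominates everything
  -- commuting with `τ`. Taking `σ = τ` and `σ = τ⁻¹` contradicts the convexity of `B`, as `τ ∉ B`.
  have hmem : ∀ σ : A, ⁅σ, τ⁆ = 1 → σ * b ∈ P := by
    intro σ hσ
    rw [← heq]
    left
    rw [commutator_mul_left, hσ, mul_one]
    exact hconj _ hbτ (hBr.comm b τ) σ
  have h1 := hmem τ (by simp)
  have h2 := hmem τ⁻¹ (by simp [commutator_inv_left])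
  rcases hP.mem_or_inv_mem (x := τ) (fun h => hτB (h ▸ B.one_mem)) with h | h
  · have h3 := hB.mul_mem_left hP h hτB (B.inv_mem hbB)
    exact hP.inv_notMem h3 (by simpa using h2)
  · have h3 := hB.mul_mem_left hP h (fun h' => hτB (B.inv_mem_iff.1 h')) (B.inv_mem hbB)
    exact hP.inv_notMem h3 (by simpa using h1)

end CommutatorCone

/-! ### Inverting elements force convexity -/

section Inverting

open scoped commutatorElement

variable {G : Type*} [Group G] {Q : Set G} {H K : Subgroup G}

/-- Two positive elements outside `K` have powers that agree modulo `K`. -/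
theorem IsRankOneMod.exists_pow_inv_mul_pow_mem (hK : IsRankOneMod K) (hQ : IsPositiveCone Q)
    (hQK : IsConvexFor Q K) {x z : G} (hx : x ∈ Q) (hxK : x ∉ K) (hz : z ∈ Q) (hzK : z ∉ K) :
    ∃ i j : ℕ, i ≠ 0 ∧ j ≠ 0 ∧ (x ^ i)⁻¹ * z ^ j ∈ K := by
  have := hK.normal
  have hmk := hQK.mk_mem_quotientCone hQ
  obtain ⟨m, k, hm, hmk'⟩ := hK.rank x z hzK
  obtain ⟨i, j, hi, hj, hij⟩ := (hQK.isPositiveCone_quotientCone hQ).exists_pow_eq_pow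
    ((hmk x).2 ⟨hx, hxK⟩) ((hmk z).2 ⟨hz, hzK⟩) hm (k := k) (by
      rw [← QuotientGroup.mk_zpow, ← QuotientGroup.mk_zpow, ← mul_inv_eq_one,
        ← QuotientGroup.mk_inv, ← QuotientGroup.mk_mul, QuotientGroup.eq_one_iff]
      exact hmk')
  rw [← QuotientGroup.mk_pow, ← QuotientGroup.mk_pow, QuotientGroup.eq] at hij
  exact ⟨i, j, hi, hj, hij⟩

/-- If the quotient by `K` has rank one, then every element is below a power of `z`. -/
theorem IsRankOneMod.exists_inv_mul_pow_mem (hK : IsRankOneMod K) (hQ : IsPositiveCone Q)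
    (hQK : IsConvexFor Q K) {z : G} (hz : z ∈ Q) (hzK : z ∉ K) (h : G) :
    ∃ n : ℕ, h⁻¹ * z ^ n ∈ Q := by
  rcases hQ.trichotomy h with hh | rfl | hh
  · by_cases hhK : h ∈ K
    · exact ⟨1, by simpa using hQK.mul_mem_left hQ hz hzK (K.inv_mem hhK)⟩
    obtain ⟨i, j, hi, hj, hij⟩ := hK.exists_pow_inv_mul_pow_mem hQ hQK hh hhK hz hzK
    refine ⟨j + 1, ?_⟩
    have h1 : (h ^ i)⁻¹ * z ^ (j + 1) ∈ Q := by
      rw [pow_succ, ← mul_assoc]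
      exact hQK.mul_mem_left hQ hz hzK hij
    obtain ⟨l, rfl⟩ := Nat.exists_eq_succ_of_ne_zero hi
    have e : h⁻¹ * z ^ (j + 1) = h ^ l * ((h ^ (l + 1))⁻¹ * z ^ (j + 1)) := by
      rw [pow_succ]
      group
    rw [e]
    rcases eq_or_ne l 0 with rfl | hl
    · simpa using h1
    · exact hQ.mul_mem (hQ.pow_mem hh hl) h1
  · exact ⟨1, by simpa using hz⟩
  · exact ⟨0, by simpa using hh⟩

/-- An element with a power that is a positive power of a positive element modulo `K` is
positive. -/
theorem IsConvexFor.mem_of_pow_inv_mul_pow_mem (hQK : IsConvexFor Q K) (hQ : IsPositiveCone Q)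
    {x z : G} {i j : ℕ} (hz : z ∈ Q) (hzK : z ∉ K) (hj : j ≠ 0)
    (hij : (x ^ i)⁻¹ * z ^ j ∈ K) : x ∈ Q := by
  refine hQ.mem_of_pow_mem (n := i) ?_
  have e : x ^ i = z ^ j * ((x ^ i)⁻¹ * z ^ j)⁻¹ := by group
  rw [e]
  exact hQK.mul_mem_right hQ (hQ.pow_mem hz hj)
    (fun h => hzK (hQK.mem_of_pow_mem hQ hj h)) (K.inv_mem hij)

/-- If an automorphism preserving `K` inverts one order modulo `K`, then it inverts every order
modulo `K`. -/
theorem IsRankOneMod.inv_apply_mem (hK : IsRankOneMod K) {P : Set G} (hP : IsPositiveCone P)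
    (hPK : IsConvexFor P K) (hQ : IsPositiveCone Q) (hQK : IsConvexFor Q K) (φ : G ≃* G)
    (hφ : ∀ x, φ x ∈ K ↔ x ∈ K) {p : G} (hp : p ∈ P) (hpK : p ∉ K) (hφp : (φ p)⁻¹ ∈ P)
    {x : G} (hx : x ∈ Q) (hxK : x ∉ K) : (φ x)⁻¹ ∈ Q := by
  have := hK.normal
  have hinvK : ∀ y : G, y⁻¹ ∈ K ↔ y ∈ K := fun y => K.inv_mem_iff
  have hcancel : ∀ a b : G, a⁻¹ * b ∈ K → (a⁻¹)⁻¹ * b⁻¹ ∈ K := by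
    intro a b hab
    have h1 : b⁻¹ * a ∈ K := by simpa using K.inv_mem hab
    simpa using this.mem_comm h1
  obtain ⟨q, hqQ, hqK, hφq⟩ : ∃ q ∈ Q, q ∉ K ∧ (φ q)⁻¹ ∈ Q := by
    obtain ⟨i, j, hi, hj, hij⟩ := hK.exists_pow_inv_mul_pow_mem hP hPK hφp
      (by rwa [hinvK, hφ]) hp hpK
    rcases hQ.mem_or_inv_mem (x := p) (fun h => hpK (h ▸ K.one_mem)) with h | h
    · exact ⟨p, h, hpK, hQK.mem_of_pow_inv_mul_pow_mem hQ h hpK hj hij⟩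
    · refine ⟨p⁻¹, h, by rwa [hinvK], ?_⟩
      refine hQK.mem_of_pow_inv_mul_pow_mem hQ h (by rwa [hinvK]) hj (i := i) ?_
      have := hcancel _ _ hij
      simpa using this
  obtain ⟨i, j, hi, hj, hij⟩ := hK.exists_pow_inv_mul_pow_mem hQ hQK hx hxK hqQ hqK
  refine hQK.mem_of_pow_inv_mul_pow_mem hQ hφq (by rwa [hinvK, hφ]) hj (i := i) ?_
  have h1 : (φ x ^ i)⁻¹ * φ q ^ j ∈ K := by simpa using (hφ _).2 hij
  simpa using hcancel _ _ h1

/-- If some element inverts the order on `H / K`, then `H` is convex. -/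
theorem isConvexFor_of_inverting (hQ : IsPositiveCone Q) (hH : H.Normal) (hK : K.Normal)
    (hdich : ∀ f : G, (∀ x ∈ Q, x ∈ H → x ∉ K → f * x * f⁻¹ ∈ Q) ∨
      ∀ x ∈ Q, x ∈ H → x ∉ K → (f * x * f⁻¹)⁻¹ ∈ Q)
    (hpres : ∀ f ∈ H, ∀ x ∈ Q, x ∈ H → x ∉ K → f * x * f⁻¹ ∈ Q)
    (harch : ∀ z ∈ Q, z ∈ H → z ∉ K → ∀ h ∈ H, ∃ n : ℕ, h⁻¹ * z ^ n ∈ Q)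
    (hne : ∃ x ∈ Q, x ∈ H ∧ x ∉ K)
    (hrank : ∀ f g : G, f ∉ H → g ∉ H → ∃ m k : ℤ, m ≠ 0 ∧ k ≠ 0 ∧ f ^ m * (g ^ k)⁻¹ ∈ H)
    (hinv : ∃ g : G, ∀ x ∈ Q, x ∈ H → x ∉ K → (g * x * g⁻¹)⁻¹ ∈ Q) : IsConvexFor Q H := by
  obtain ⟨x₀, hx₀, hx₀H, hx₀K⟩ := hne
  let Inv : G → Prop := fun f => (f * x₀ * f⁻¹)⁻¹ ∈ Q
  have hInv : ∀ f, Inv f → ∀ x ∈ Q, x ∈ H → x ∉ K → (f * x * f⁻¹)⁻¹ ∈ Q := by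
    intro f hf
    rcases hdich f with h | h
    · exact absurd hf (hQ.inv_notMem (h x₀ hx₀ hx₀H hx₀K))
    · exact h
  have hPres : ∀ f, ¬ Inv f → ∀ x ∈ Q, x ∈ H → x ∉ K → f * x * f⁻¹ ∈ Q := by
    intro f hf
    exact (hdich f).resolve_right fun h => hf (h x₀ hx₀ hx₀H hx₀K)
  have hconjK : ∀ f x : G, x ∉ K → f * x * f⁻¹ ∉ K := fun f x hx h =>
    hx (by simpa [mul_assoc] using hK.conj_mem _ h f⁻¹)
  have hInvMul : ∀ f g, ¬ Inv f → Inv g → Inv (f * g) := by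
    intro f g hf hg
    have h1 := hPres f hf _ hg (H.inv_mem (hH.conj_mem _ hx₀H g))
      (fun h => hconjK g x₀ hx₀K (K.inv_mem_iff.1 h))
    change (f * g * x₀ * (f * g)⁻¹)⁻¹ ∈ Q
    simpa [mul_assoc] using h1
  have hInvMul' : ∀ f g, Inv f → ¬ Inv g → Inv (f * g) := by
    intro f g hf hg
    have h1 := hInv f hf _ (hPres g hg x₀ hx₀ hx₀H hx₀K) (hH.conj_mem _ hx₀H g)
      (hconjK g x₀ hx₀K)
    change (f * g * x₀ * (f * g)⁻¹)⁻¹ ∈ Q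
    simpa [mul_assoc] using h1
  have hInvInv : ∀ f, Inv f → Inv f⁻¹ := by
    intro f hf
    by_contra hcon
    have h1 := hInvMul _ _ hcon hf
    rw [inv_mul_cancel] at h1
    exact hQ.inv_notMem hx₀ (by simpa [Inv] using h1)
  have hPresH : ∀ f ∈ H, ¬ Inv f := fun f hf h =>
    hQ.inv_notMem (hpres f hf x₀ hx₀ hx₀H hx₀K) h
  -- positive inverting elements lie above `H`
  have step1 : ∀ f ∈ Q, Inv f → ∀ h ∈ H, h⁻¹ * f ∈ Q := by
    intro f hfQ hf h hh
    obtain ⟨n, hn⟩ := harch _ hf (H.inv_mem (hH.conj_mem _ hx₀H f))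
      (fun h => hconjK f x₀ hx₀K (K.inv_mem_iff.1 h)) h hh
    -- With `z = (f * x₀ * f⁻¹)⁻¹` one has `z ^ n * (f * x₀ ^ n) = f`, so `h⁻¹ * f` is the product
    -- of `h⁻¹ * z ^ n` and `f * x₀ ^ n`.
    have h1 : f * x₀ ^ n ∈ Q := by
      rcases eq_or_ne n 0 with rfl | hn0
      · simpa using hfQ
      · exact hQ.mul_mem hfQ (hQ.pow_mem hx₀ hn0)
    have h2 := hQ.mul_mem hn h1
    rw [inv_pow, conj_pow] at h2
    simpa [mul_assoc] using h2
  obtain ⟨g, hgQ, hg⟩ : ∃ g ∈ Q, Inv g := by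
    obtain ⟨g, hg⟩ := hinv
    have hg' : Inv g := hg x₀ hx₀ hx₀H hx₀K
    rcases hQ.trichotomy g with h | rfl | h
    · exact ⟨g, h, hg'⟩
    · exact absurd hg' (hPresH 1 H.one_mem)
    · exact ⟨g⁻¹, h, hInvInv g hg'⟩
  have hgH : g ∉ H := fun h => hPresH g h hg
  have hgy : ∀ y ∈ H, g * y ∈ Q ∧ Inv (g * y) := by
    intro y hy
    refine ⟨?_, hInvMul' g y hg (hPresH y hy)⟩
    have h1 := step1 g hgQ hg (g * y⁻¹ * g⁻¹) (hH.conj_mem _ (H.inv_mem hy) g)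
    simpa [mul_assoc] using h1
  -- all positive elements outside `H` lie above `H`
  have step2 : ∀ f ∈ Q, f ∉ H → ∀ h ∈ H, h⁻¹ * f ∈ Q := by
    intro f hfQ hfH h hh
    by_cases hf : Inv f
    · exact step1 f hfQ hf h hh
    by_contra hcon
    have hlt : f⁻¹ * h ∈ Q := by
      have := hQ.inv_mem_of_notMem (fun h' => hfH (by rwa [← inv_mul_eq_one.1 h'])) hcon
      simpa using this
    have hf' : ¬ Inv f⁻¹ := fun h => hf (by simpa using hInvInv _ h)
    -- If `f < h` with `h ∈ H`, then `f⁻¹ * u` is again positive and inverting whenever `u` is, so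
    -- all powers of `f` lie below every such `u`.
    have hbelow : ∀ (m : ℕ) (u : G), u ∈ Q → Inv u → (f ^ m)⁻¹ * u ∈ Q := by
      intro m
      induction m with
      | zero => intro u hu _; simpa using hu
      | succ m ih =>
        intro u hu huI
        have h1 : f⁻¹ * u ∈ Q := by
          simpa [mul_assoc] using hQ.mul_mem hlt (step1 u hu huI h hh)
        have h2 := ih _ h1 (hInvMul _ _ hf' huI)
        rw [pow_succ', mul_inv_rev, mul_assoc]
        exact h2
    obtain ⟨m, k, hm, hk, y, hy, hfm⟩ : ∃ (m : ℕ) (k : ℤ), m ≠ 0 ∧ k ≠ 0 ∧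
        ∃ y ∈ H, f ^ m = g ^ k * y := by
      have key : ∀ (m k : ℤ), f ^ m * (g ^ k)⁻¹ ∈ H → (g ^ k)⁻¹ * f ^ m ∈ H := fun m k h =>
        hH.mem_comm h
      obtain ⟨m, k, hm, hk, hmk⟩ := hrank f g hfH hgH
      rcases Int.natAbs_eq m with h1 | h1
      · refine ⟨m.natAbs, k, Int.natAbs_ne_zero.2 hm, hk, _, key _ _ hmk, ?_⟩
        rw [mul_inv_cancel_left, ← zpow_natCast, ← h1]
      · refine ⟨m.natAbs, -k, Int.natAbs_ne_zero.2 hm, neg_ne_zero.2 hk,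
          (f ^ m * (g ^ k)⁻¹)⁻¹, H.inv_mem hmk, ?_⟩
        rw [mul_inv_rev, inv_inv, zpow_neg, inv_mul_cancel_left, ← zpow_natCast, ← zpow_neg]
        congr 1
        omega
    -- Each exponent in `f ^ m = g ^ k * y` is absurd: `k < 0` makes `f ^ m` negative, `k = 1` makes
    -- it a positive inverting element below itself, and `k ≥ 2` puts it above `g`.
    rcases lt_or_gt_of_ne hk with hk | hk
    · obtain ⟨l, hl⟩ := Int.eq_ofNat_of_zero_le (show 0 ≤ -k - 1 by omega)
      have hkl : k = -((l + 1 : ℕ) : ℤ) := by push_cast; omega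
      rw [hkl, zpow_neg, zpow_natCast] at hfm
      have h1 := step1 g hgQ hg y hy
      have h2 : (f ^ m)⁻¹ = y⁻¹ * g * g ^ l := by
        rw [hfm, pow_succ']
        group
      refine hQ.inv_notMem (hQ.pow_mem hfQ hm) ?_
      rw [h2]
      rcases eq_or_ne l 0 with rfl | hl0
      · simpa using h1
      · exact hQ.mul_mem h1 (hQ.pow_mem hgQ hl0)
    · obtain ⟨l, hl⟩ := Int.eq_ofNat_of_zero_le (show 0 ≤ k - 1 by omega)
      have hkl : k = ((l + 1 : ℕ) : ℤ) := by push_cast; omega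
      rw [hkl, zpow_natCast] at hfm
      rcases Nat.eq_zero_or_pos l with rfl | hl0
      · have h1 := hbelow m (g * y) (hgy y hy).1 (hgy y hy).2
        rw [hfm] at h1
        exact hQ.one_notMem (by simpa using h1)
      · obtain ⟨j, rfl⟩ := Nat.exists_eq_succ_of_ne_zero hl0.ne'
        have h1 := hbelow m g hgQ hg
        have h2 : g ^ j * (g * y) ∈ Q := by
          rcases eq_or_ne j 0 with rfl | hj
          · simpa using (hgy y hy).1
          · exact hQ.mul_mem (hQ.pow_mem hgQ hj) (hgy y hy).1
        have h3 : ((f ^ m)⁻¹ * g)⁻¹ = g ^ j * (g * y) := by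
          rw [mul_inv_rev, inv_inv, hfm, Nat.succ_eq_add_one, pow_succ', pow_succ]
          group
        exact hQ.inv_notMem h1 (h3 ▸ h2)
  intro x hx y hy hxy
  by_contra hxH
  have h1 := step2 x hx hxH _ hxy
  exact hQ.inv_notMem hy (by simpa using h1)

end Inverting

/-! ### Tame groups and the induction -/

section Tame

open scoped commutatorElement

variable {G : Type*} [Group G]

/-- A group with finitely many left-orders, which is trivial or has a subgroup that is convex for
all left-orders and has a commutative quotient of rank one. -/
structure IsTame (G : Type*) [Group G] : Prop where
  finite : Finite (LO G)
  exists_subgroup : Subsingleton G ∨ ∃ K : Subgroup G, K ≠ ⊤ ∧ IsRankOneMod K ∧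
    ∀ Q : Set G, IsPositiveCone Q → IsConvexFor Q K

/-- An order is determined by its restriction to `H` and the sign of one element outside `H`: rank
one transfers that sign to every other element outside `H`. -/
theorem IsRankOneMod.finite_LO {H : Subgroup G} (hH : IsRankOneMod H) (hne : H ≠ ⊤)
    (hconv : ∀ Q : Set G, IsPositiveCone Q → IsConvexFor Q H) [Finite (LO H)] :
    Finite (LO G) := by
  obtain ⟨p, hp⟩ : ∃ p, p ∉ H := by
    by_contra! hcon
    exact hne (eq_top_iff.2 fun x _ => hcon x)
  have hp1 : p ≠ 1 := fun h => hp (h ▸ H.one_mem)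
  let F : LO G → LO H × Prop := fun Q =>
    (⟨H.subtype ⁻¹' Q.1, Q.2.preimage H.subtype_injective⟩, p ∈ Q.1)
  refine Finite.of_injective F fun Q R hQR => LO.ext ?_
  have h1 : H.subtype ⁻¹' Q.1 = H.subtype ⁻¹' R.1 := congrArg Subtype.val (Prod.ext_iff.1 hQR).1
  have h2 : p ∈ Q.1 ↔ p ∈ R.1 := iff_of_eq (Prod.ext_iff.1 hQR).2
  obtain ⟨q, hqQ, hqR, hqH⟩ : ∃ q, q ∈ Q.1 ∧ q ∈ R.1 ∧ q ∉ H := by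
    rcases Q.2.mem_or_inv_mem hp1 with h | h
    · exact ⟨p, h, h2.1 h, hp⟩
    · refine ⟨p⁻¹, h, R.2.inv_mem_of_notMem hp1 fun h' => ?_, fun h' => hp (H.inv_mem_iff.1 h')⟩
      exact Q.2.inv_notMem (h2.2 h') h
  refine Q.2.eq_of_subset R.2 fun x hx => ?_
  by_cases hxH : x ∈ H
  · have : (⟨x, hxH⟩ : H) ∈ H.subtype ⁻¹' R.1 := h1 ▸ hx
    exact this
  · obtain ⟨i, j, hi, hj, hij⟩ :=
      hH.exists_pow_inv_mul_pow_mem Q.2 (hconv _ Q.2) hx hxH hqQ hqH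
    exact (hconv _ R.2).mem_of_pow_inv_mul_pow_mem R.2 hqR hqH hj hij

theorem IsConvexFor.comap {H : Type*} [Group H] {P : Set G} {C : Subgroup G}
    (hC : IsConvexFor P C) (f : H →* G) : IsConvexFor (f ⁻¹' P) (C.comap f) := by
  intro x hx y hy hxy
  refine hC (f x) hx (f y) hy ?_
  rw [← map_mul]
  exact hxy

/-- `K` and its preimage under an automorphism are both convex for `P`, hence comparable. A strictly
larger preimage would contain a power of every element, hence be the whole group. Characteristicity
makes the image of `K` normal in the ambient group. -/
theorem IsRankOneMod.characteristic {K : Subgroup G} (hK : IsRankOneMod K) (hne : K ≠ ⊤)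
    (hconv : ∀ Q : Set G, IsPositiveCone Q → IsConvexFor Q K) {P : Set G}
    (hP : IsPositiveCone P) : K.Characteristic := by
  rw [Subgroup.characteristic_iff_comap_le]
  intro φ
  have hPφ : IsConvexFor P (K.comap φ.toMonoidHom) := by
    have h1 := (hconv _ (hP.preimage (f := φ.symm.toMonoidHom) φ.symm.injective)).comap
      φ.toMonoidHom
    convert h1 using 1
    ext x
    simp
  rcases (hconv P hP).le_or_le hPφ hP with h | h
  · intro x hx
    by_contra hxK
    refine hne (eq_top_iff.2 fun b _ => ?_)
    have htop : ∀ b : G, b ∈ K.comap φ.toMonoidHom := by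
      intro b
      obtain ⟨m, k, hm, hmk⟩ := hK.rank b x hxK
      refine hPφ.mem_of_zpow_mem hP hm ?_
      have h1 := Subgroup.mul_mem _ (h hmk) (Subgroup.zpow_mem _ hx k)
      rwa [inv_mul_cancel_right] at h1
    have h1 : φ (φ.symm b) ∈ K := htop (φ.symm b)
    simpa using h1
  · exact h

/-- The largest proper convex subgroup of an isolated order on a group without condensed orders
has a commutative quotient of rank one. -/
theorem IsolatedBy.isRankOneMod {P : Set G} {S : Finset G} (hS : IsolatedBy P S)
    (hnc : ∀ Q : Set G, IsPositiveCone Q → ¬ IsCondensed Q) {H : Subgroup G}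
    (hH : IsConvexFor P H) (hne : H ≠ ⊤)
    (hmax : ∀ D : Subgroup G, IsConvexFor P D → D ≠ ⊤ → D ≤ H) : IsRankOneMod H := by
  have hP := hS.cone
  rcases hH.exists_isCondensed_or hP hne hmax with ⟨Q, hQ, hQc⟩ | ⟨hHn, hconj, harch⟩
  · exact absurd hQc (hnc Q hQ)
  have hquot := hH.isPositiveCone_quotientCone hP
  have hmk := hH.mk_mem_quotientCone hP
  have hinvH : ∀ p : G, p⁻¹ ∈ H ↔ p ∈ H := fun p => H.inv_mem_iff
  have hcomm : ∀ a b : G ⧸ H, a * b = b * a := by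
    refine hquot.mul_comm_of_archimedean ?_ ?_
    · intro x hx y
      obtain ⟨p, rfl⟩ := QuotientGroup.mk_surjective x
      obtain ⟨g, rfl⟩ := QuotientGroup.mk_surjective y
      rw [hmk] at hx
      rw [← QuotientGroup.mk_inv, ← QuotientGroup.mk_mul, ← QuotientGroup.mk_mul, hmk]
      exact ⟨hconj p hx.1 hx.2 g, fun h => hx.2
        (by simpa [mul_assoc] using hHn.conj_mem _ h g⁻¹)⟩
    · intro x hx y
      obtain ⟨p, rfl⟩ := QuotientGroup.mk_surjective x
      obtain ⟨g, rfl⟩ := QuotientGroup.mk_surjective y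
      rw [hmk] at hx
      obtain ⟨n, hn⟩ := harch p hx.1 hx.2 g
      refine ⟨n + 1, ?_⟩
      rw [← QuotientGroup.mk_inv, ← QuotientGroup.mk_pow, ← QuotientGroup.mk_mul, hmk]
      have e : g⁻¹ * p ^ (n + 1) = g⁻¹ * p ^ n * p := by rw [pow_succ, mul_assoc]
      rw [e]
      exact ⟨hP.mul_mem hn hx.1, hH.notMem_mul' hn hx.1 hx.2⟩
  obtain ⟨T, hT⟩ := hH.exists_isolatedBy_quotientCone hS
  refine ⟨hHn, fun a b => ?_, fun a b hb => ?_⟩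
  · rw [← QuotientGroup.eq_one_iff, commutatorElement_def]
    simp only [QuotientGroup.mk_mul, QuotientGroup.mk_inv]
    rw [hcomm a b]
    group
  · let _ : CommGroup (G ⧸ H) := { (inferInstance : Group (G ⧸ H)) with mul_comm := hcomm }
    obtain ⟨m, k, hm, hmk'⟩ := IsolatedBy.exists_zpow_eq_zpow hT (a : G ⧸ H) (b := (b : G ⧸ H))
      (fun h => hb ((QuotientGroup.eq_one_iff b).1 h))
    refine ⟨m, k, hm, ?_⟩
    rw [← QuotientGroup.eq_one_iff]
    have h1 : ((a ^ m * (b ^ k)⁻¹ : G) : G ⧸ H) = (a : G ⧸ H) ^ m * ((b : G ⧸ H) ^ k)⁻¹ := rfl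
    rw [h1]
    exact mul_inv_eq_one.2 hmk'

/-- The subgroup `H` is convex for every left-order as soon as the order on `H / K` is inverted by
some element. -/
theorem isConvexFor_of_exists_inverting {P : Set G} (hP : IsPositiveCone P) {H : Subgroup G}
    (hH : IsConvexFor P H) (hHr : IsRankOneMod H) {K : Subgroup H} (hKr : IsRankOneMod K)
    [hKc : K.Characteristic] (hKconv : ∀ Q : Set H, IsPositiveCone Q → IsConvexFor Q K)
    {g p : G} (hp : p ∈ P) (hpH : p ∈ H) (hpK : p ∉ K.map H.subtype) (hg : g * p * g⁻¹ ∉ P)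
    {Q : Set G} (hQ : IsPositiveCone Q) : IsConvexFor Q H := by
  have hHn := hHr.normal
  have hK₂n : (K.map H.subtype).Normal := inferInstance
  have hmem : ∀ x : H, (x : G) ∈ K.map H.subtype ↔ x ∈ K := fun x => by
    constructor
    · rintro ⟨y, hy, hyx⟩
      rwa [← Subtype.ext hyx]
    · exact fun hx => ⟨x, hx, rfl⟩
  have hPH := hP.preimage H.subtype_injective
  have hQH := hQ.preimage H.subtype_injective
  have hφ : ∀ (f : G) (x : H), MulAut.conjNormal f x ∈ K ↔ x ∈ K := by
    intro f x
    have h1 := Subgroup.characteristic_iff_comap_eq.1 hKc (MulAut.conjNormal f)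
    conv_rhs => rw [← h1]
    rfl
  have hinv : ∀ (R : Set G), IsPositiveCone R → ∀ f y : G, y ∈ R → y ∈ H → y ∉ K.map H.subtype →
      f * y * f⁻¹ ∉ R → ∀ x ∈ Q, x ∈ H → x ∉ K.map H.subtype → (f * x * f⁻¹)⁻¹ ∈ Q := by
    intro R hR f y hy hyH hyK hfy x hx hxH hxK
    have h1 : (f * y * f⁻¹)⁻¹ ∈ R := hR.inv_mem_of_notMem
      (fun h => hR.ne_one hy (by simpa using h)) hfy
    have h2 := hKr.inv_apply_mem (hR.preimage H.subtype_injective)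
      (hKconv _ (hR.preimage H.subtype_injective)) hQH (hKconv _ hQH) (MulAut.conjNormal f)
      (hφ f) (p := ⟨y, hyH⟩) hy (fun h => hyK ((hmem _).2 h))
      (by simpa using h1) (x := ⟨x, hxH⟩) hx (fun h => hxK ((hmem _).2 h))
    simpa using h2
  have hdich : ∀ f : G, (∀ x ∈ Q, x ∈ H → x ∉ K.map H.subtype → f * x * f⁻¹ ∈ Q) ∨
      ∀ x ∈ Q, x ∈ H → x ∉ K.map H.subtype → (f * x * f⁻¹)⁻¹ ∈ Q := by
    intro f
    by_cases hall : ∀ x ∈ Q, x ∈ H → x ∉ K.map H.subtype → f * x * f⁻¹ ∈ Q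
    · exact Or.inl hall
    · push Not at hall
      obtain ⟨y, hy, hyH, hyK, hfy⟩ := hall
      exact Or.inr (hinv Q hQ f y hy hyH hyK hfy)
  refine isConvexFor_of_inverting hQ hHn hK₂n hdich ?_ ?_ ?_ ?_
    ⟨g, hinv P hP g p hp hpH hpK hg⟩
  · intro f hf x hx hxH hxK
    -- Elements of `H` act trivially on the commutative quotient `H ⧸ K`, so they preserve its
    -- order.
    have h1 := hKr.comm ⟨x, hxH⟩⁻¹ ⟨f, hf⟩
    have h2 : (⟨x, hxH⟩ : H) * ⁅(⟨x, hxH⟩ : H)⁻¹, ⟨f, hf⟩⁆ ∈ H.subtype ⁻¹' Q :=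
      (hKconv _ hQH).mul_mem_right hQH hx (fun h => hxK ((hmem _).2 h)) h1
    have h3 : H.subtype ((⟨x, hxH⟩ : H) * ⁅(⟨x, hxH⟩ : H)⁻¹, ⟨f, hf⟩⁆) = f * x * f⁻¹ := by
      simp [commutatorElement_def, mul_assoc]
    rw [Set.mem_preimage, h3] at h2
    exact h2
  · intro z hz hzH hzK h hh
    obtain ⟨n, hn⟩ := hKr.exists_inv_mul_pow_mem hQH (hKconv _ hQH) (z := ⟨z, hzH⟩) hz
      (fun h => hzK ((hmem _).2 h)) ⟨h, hh⟩
    exact ⟨n, by simpa using hn⟩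
  · rcases hQ.mem_or_inv_mem (hP.ne_one hp) with h | h
    · exact ⟨p, h, hpH, hpK⟩
    · exact ⟨p⁻¹, h, H.inv_mem hpH, fun h' => hpK (Subgroup.inv_mem_iff _ |>.1 h')⟩
  · intro f f' hf hf'
    obtain ⟨m, k, hm, hmk⟩ := hHr.rank f f' hf'
    refine ⟨m, k, hm, ?_, hmk⟩
    rintro rfl
    exact hf (hH.mem_of_zpow_mem hP hm (by simpa using hmk))

/-- If the order is isolated, then some element inverts the order on `H / K`. -/
theorem IsolatedBy.exists_inverting {P : Set G} {S : Finset G} (hS : IsolatedBy P S)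
    {H : Subgroup G} (hH : IsConvexFor P H) (hHr : IsRankOneMod H) (hHne : H ≠ ⊤)
    {K : Subgroup H} (hKne : K ≠ ⊤) (hKr : IsRankOneMod K) [hKc : K.Characteristic]
    (hKconv : ∀ Q : Set H, IsPositiveCone Q → IsConvexFor Q K) :
    ∃ g, ∃ p ∈ P, p ∈ H ∧ p ∉ K.map H.subtype ∧ g * p * g⁻¹ ∉ P := by
  by_contra! hcon
  have hP := hS.cone
  have hHn := hHr.normal
  set K₂ := K.map H.subtype with hK₂
  have hK₂n : K₂.Normal := inferInstance
  have hK₂H : K₂ ≤ H := Subgroup.map_subtype_le K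
  have hmem : ∀ x : H, (x : G) ∈ K₂ ↔ x ∈ K := fun x => by
    constructor
    · rintro ⟨y, hy, hyx⟩
      rwa [← Subtype.ext hyx]
    · exact fun hx => ⟨x, hx, rfl⟩
  have hPH := hP.preimage H.subtype_injective
  have hK₂P : IsConvexFor P K₂ := by
    intro x hx y hy hxy
    have hxH := hH x hx y hy (hK₂H hxy)
    have hyH : y ∈ H := (H.mul_mem_cancel_left hxH).1 (hK₂H hxy)
    exact (hmem ⟨x, hxH⟩).2 (hKconv _ hPH ⟨x, hxH⟩ hx ⟨y, hyH⟩ hy ((hmem _).1 hxy))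
  have hmk := hK₂P.mk_mem_quotientCone hP
  let B : Subgroup (G ⧸ K₂) := H.map (QuotientGroup.mk' K₂)
  have hB : ∀ x : G, (x : G ⧸ K₂) ∈ B ↔ x ∈ H := by
    intro x
    constructor
    · rintro ⟨y, hy, hyx⟩
      have h1 : y⁻¹ * x ∈ K₂ := QuotientGroup.eq.1 hyx
      exact (H.mul_mem_cancel_left (H.inv_mem hy)).1 (hK₂H h1)
    · exact fun hx => ⟨x, hx, rfl⟩
  have hlift : ∀ x ∈ B, ∃ y : H, ((y : G) : G ⧸ K₂) = x := by
    rintro _ ⟨y, hy, rfl⟩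
    exact ⟨⟨y, hy⟩, rfl⟩
  obtain ⟨T, hT⟩ := hK₂P.exists_isolatedBy_quotientCone hS
  -- Dividing by `K₂` leaves an isolated order with two rank one jumps, the lower being the image
  -- `B` of `H`; absence of inversion is exactly conjugation invariance on `B`.
  refine not_isolatedBy_of_conj_mem (P := IsConvexFor.quotientCone P K₂) (B := B) ?_
    ⟨hHn.map _ (QuotientGroup.mk'_surjective K₂), ?_, ?_⟩ ?_ ?_ ?_ ?_ ?_ T hT
  · intro x hx y hy hxy
    obtain ⟨a, rfl⟩ := QuotientGroup.mk_surjective x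
    obtain ⟨b, rfl⟩ := QuotientGroup.mk_surjective y
    rw [hmk] at hx hy
    rw [← QuotientGroup.mk_mul, hB] at hxy
    exact (hB a).2 (hH a hx.1 b hy.1 hxy)
  · intro x y
    obtain ⟨a, rfl⟩ := QuotientGroup.mk_surjective x
    obtain ⟨b, rfl⟩ := QuotientGroup.mk_surjective y
    exact (hB ⁅a, b⁆).2 (hHr.comm a b)
  · intro x y hy
    obtain ⟨a, rfl⟩ := QuotientGroup.mk_surjective x
    obtain ⟨b, rfl⟩ := QuotientGroup.mk_surjective y
    rw [hB] at hy
    obtain ⟨m, k, hm, hmk'⟩ := hHr.rank a b hy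
    exact ⟨m, k, hm, (hB _).2 hmk'⟩
  · intro hbot
    refine hKne (eq_top_iff.2 fun x _ => ?_)
    have h1 := (hB x).2 x.2
    rw [hbot, Subgroup.mem_bot, QuotientGroup.eq_one_iff] at h1
    exact (hmem x).1 h1
  · intro htop
    refine hHne (eq_top_iff.2 fun x _ => ?_)
    exact (hB x).1 (htop ▸ Subgroup.mem_top _)
  · intro x hx hxB y
    obtain ⟨p, rfl⟩ := QuotientGroup.mk_surjective x
    obtain ⟨g, rfl⟩ := QuotientGroup.mk_surjective y
    rw [hmk] at hx
    rw [hB] at hxB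
    exact (hmk (g * p * g⁻¹)).2 ⟨hcon g p hx.1 hxB hx.2, fun h => hx.2
      (by simpa [mul_assoc] using hK₂n.conj_mem _ h g⁻¹)⟩
  · intro x hx y hy
    obtain ⟨a, rfl⟩ := hlift x hx
    obtain ⟨b, rfl⟩ := hlift y hy
    rw [← commutatorElement_eq_one_iff_mul_comm]
    exact (QuotientGroup.eq_one_iff (N := K₂) ⁅(a : G), (b : G)⁆).2 ((hmem _).2 (hKr.comm a b))
  · intro x hx y hy hy1
    obtain ⟨a, rfl⟩ := hlift x hx
    obtain ⟨b, rfl⟩ := hlift y hy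
    have hb : b ∉ K := fun h => hy1 ((QuotientGroup.eq_one_iff _).2 ((hmem b).2 h))
    obtain ⟨m, k, hm, hmk'⟩ := hKr.rank a b hb
    refine ⟨m, k, hm, ?_⟩
    rw [← mul_inv_eq_one]
    exact (QuotientGroup.eq_one_iff (N := K₂) ((a : G) ^ m * ((b : G) ^ k)⁻¹)).2
      ((hmem _).2 hmk')

/-- A group with an isolated left-order and without condensed left-orders is tame. -/
theorem IsolatedBy.isTame {G : Type u} [Group G] {P : Set G} {S : Finset G} (hS : IsolatedBy P S)
    (hnc : ∀ Q : Set G, IsPositiveCone Q → ¬ IsCondensed Q) : IsTame G := by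
  classical
  induction hn : S.card using Nat.strong_induction_on generalizing G with
  | _ n ih =>
  have hP := hS.cone
  rcases subsingleton_or_nontrivial G with hG | hG
  · exact ⟨Finite.of_injective Subtype.val Subtype.val_injective, Or.inl hG⟩
  obtain ⟨H, hH, hHne, hmax, s, hs, hsH⟩ := hS.exists_isConvexFor
  have hHr := hS.isRankOneMod hnc hH hHne hmax
  -- The element `s` lies outside `H`, so the restricted order is isolated by strictly fewer
  -- elements.
  have hHtame : IsTame H := by
    refine ih _ ?_ (hH.isolatedBy hS) (fun Q hQ hc => hnc _ (hH.isPositiveCone_extend hP hQ)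
      (hH.isCondensed_extend hP hc)) rfl
    rw [Finset.card_subtype, ← hn]
    exact Finset.card_lt_card (Finset.filter_ssubset.2 ⟨s, hs, hsH⟩)
  have hfin := hHtame.finite
  have hconv : ∀ Q : Set G, IsPositiveCone Q → IsConvexFor Q H := by
    intro Q hQ
    rcases hHtame.exists_subgroup with hsub | ⟨K, hKne, hKr, hKconv⟩
    · have : H = ⊥ := H.eq_bot_of_subsingleton
      rw [this]
      exact IsConvexFor.bot hQ
    · have hKc := hKr.characteristic hKne hKconv (hP.preimage H.subtype_injective)
      obtain ⟨g, p, hp, hpH, hpK, hg⟩ := hS.exists_inverting hH hHr hHne hKne hKr hKconv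
      exact isConvexFor_of_exists_inverting hP hH hHr hKr hKconv hp hpH hpK hg hQ
  exact ⟨hHr.finite_LO hHne hconv, Or.inr ⟨H, hHne, hHr, hconv⟩⟩

end Tame

theorem mainTheorem6 (G : Type u) [Group G] [Countable G] (hG : ¬ IsTararin G)
    (hiso : ∃ P : LO G, IsOpen ({P} : Set (LO G))) :
    ¬ IsSmoothRel.{u, v} (Elo G) := by
  intro hsmooth
  obtain ⟨P, hP⟩ := hiso
  obtain ⟨S, hS⟩ := LO.exists_isolatedBy hP
  refine hG ⟨⟨P⟩, (hS.isTame fun Q hQ hc => ?_).finite⟩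
  exact LO.not_isSmoothRel_of_isCondensed hQ hc hsmooth
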